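/- Let $n\ge 1$ and let $\Omega\subset\mathbb{R}^n$ be a bounded open set with Lipschitz boundary (not necessarily connected). All derivatives are taken in the sense of distributions in $\Omega$, and $L^2(\Omega)^n$ carries the inner product $(u,v)_{L^2}=\int_\Omega u\cdot v\,dx$. Let $H^1(\Omega)=\{f\in L^2(\Omega):\nabla f\in L^2(\Omega)^n\}$ with norm $(\|f\|_{L^2}^2+\|\nabla f\|_{L^2}^2)^{1/2}$, and let $H^1_0(\Omega)$ be the closure of $C_c^\infty(\Omega)$ in $H^1(\Omega)$. Let $H(\mathrm{div};\Omega)=\{v\in L^2(\Omega)^n:\operatorname{div}v\in L^2(\Omega)\}$ with norm $(\|v\|_{L^2}^2+\|\operatorname{div}v\|_{L^2}^2)^{1/2}$, and let $H_0(\mathrm{div};\Omega)$ be the closure of $C_c^\infty(\Omega)^n$ in $H(\mathrm{div};\Omega)$. Put $$\mathrm{Ker}(\mathrm{div})=\{v\in H(\mathrm{div};\Omega):\operatorname{div}v=0\},\qquad \mathrm{Ker}(\mathrm{div})_0=\mathrm{Ker}(\mathrm{div})\cap H_0(\mathrm{div};\Omega).$$ Let $H^{1/2}(\partial\Omega)=H^1(\Omega)/H^1_0(\Omega)$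 be the space of traces of $H^1$ functions. The normal trace of $v\in H(\mathrm{div};\Omega)$ is the continuous linear form $v\cdot n$ on $H^{1/2}(\partial\Omega)$ given by $\langle v\cdot n,\,f|_{\partial\Omega}\rangle=\int_\Omega v\cdot\nabla f\,dx+\int_\Omega f\operatorname{div}v\,dx$ for $f\in H^1(\Omega)$. Then: 1. $L^2(\Omega)^n=\nabla(H^1_0(\Omega))\oplus\mathrm{Ker}(\mathrm{div})$, a direct sum that is orthogonal in $L^2(\Omega)^n$. 2. $L^2(\Omega)^n=\nabla(H^1(\Omega))\oplus\mathrm{Ker}(\mathrm{div})_0$, a direct sum that is orthogonal in $L^2(\Omega)^n$. Moreover $\mathrm{Ker}(\mathrm{div})_0=\{v\in\mathrm{Ker}(\mathrm{div}):v\cdot n=0\}$. 3. For every $f\in L^2(\Omega)^n$ these decompositions are obtained as follows. - (Dirichlet problem) There is a unique $\phi\in H^1_0(\Omega)$ with $(\nabla\phi,\nabla\psi)_{L^2}=(f,\nabla\psi)_{L^2}$ for all $\psi\in H^1_0(\Omega)$, and $f-\nabla\phi\in\mathrm{Ker}(\mathrm{div})$. - (Neumann problem) There is $\phi\in H^1(\Omega)$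 with $(\nabla\phi,\nabla\psi)_{L^2}=(f,\nabla\psi)_{L^2}$ for all $\psi\in H^1(\Omega)$. Any two such $\phi$ have the same gradient, and $f-\nabla\phi\in\mathrm{Ker}(\mathrm{div})_0$ for each of them. -/

import Mathlib

open MeasureTheory TopologicalSpace
open scoped Distributions Gradient

namespace Helmholtz

/-- Euclidean space `ℝⁿ`. -/
abbrev Rn (n : ℕ) : Type := EuclideanSpace ℝ (Fin n)

/-- A set `U ⊆ ℝⁿ` has Lipschitz boundary: near each boundary point `x₀` there are a unit vector
`e` and a Lipschitz function `γ` on the hyperplane orthogonal to `e` such that `U` is locally the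
set of points lying strictly above the graph of `γ` in the direction `e`. -/
def HasLipschitzBoundary {n : ℕ} (U : Set (Rn n)) : Prop :=
  ∀ x₀ ∈ frontier U, ∃ (e : Rn n) (r : ℝ) (K : NNReal) (γ : (Submodule.span ℝ {e})ᗮ → ℝ),
    ‖e‖ = 1 ∧ 0 < r ∧ LipschitzWith K γ ∧
      ∀ x ∈ Metric.ball x₀ r,
        (x ∈ U ↔ γ ((Submodule.span ℝ {e})ᗮ.orthogonalProjectionOnto x) < inner ℝ e x)

/-- The real Hilbert space `L²(Ω)`, with inner product `∫_Ω f g`. -/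
abbrev L2 {n : ℕ} (Ω : Opens (Rn n)) : Type :=
  Lp ℝ 2 ((volume : Measure (Rn n)).restrict (Ω : Set (Rn n)))

/-- The real Hilbert space `L²(Ω)ⁿ` of vector fields, with inner product `∫_Ω v · w`. -/
abbrev L2Vec {n : ℕ} (Ω : Opens (Rn n)) : Type :=
  Lp (Rn n) 2 ((volume : Measure (Rn n)).restrict (Ω : Set (Rn n)))

/-- The Hilbert space `L²(Ω) × L²(Ω)ⁿ`, with `‖(f, F)‖² = ‖f‖² + ‖F‖²`. -/
abbrev ScalarPair {n : ℕ} (Ω : Opens (Rn n)) : Type := WithLp 2 (L2 Ω × L2Vec Ω)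

/-- The Hilbert space `L²(Ω)ⁿ × L²(Ω)`, with `‖(v, q)‖² = ‖v‖² + ‖q‖²`. -/
abbrev VectorPair {n : ℕ} (Ω : Opens (Rn n)) : Type := WithLp 2 (L2Vec Ω × L2 Ω)

/-- The classical divergence `∑ᵢ ∂ᵢ Vᵢ` of a differentiable vector field. -/
noncomputable def divergence {n : ℕ} (V : Rn n → Rn n) (x : Rn n) : ℝ :=
  ∑ i, (fderiv ℝ V x (EuclideanSpace.single i 1)) i

/-- `F` is the distributional gradient of `f` in `Ω`. -/
def HasWeakGradient {n : ℕ} {Ω : Opens (Rn n)} (f : L2 Ω) (F : L2Vec Ω) : Prop :=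
  ∀ Ψ : 𝓓(Ω, Rn n),
    ∫ x in (Ω : Set (Rn n)), inner ℝ (F x) (Ψ x) =
      -∫ x in (Ω : Set (Rn n)), f x * divergence Ψ x

/-- `q` is the distributional divergence of `v` in `Ω`. -/
def HasWeakDivergence {n : ℕ} {Ω : Opens (Rn n)} (v : L2Vec Ω) (q : L2 Ω) : Prop :=
  ∀ ψ : 𝓓(Ω, ℝ),
    ∫ x in (Ω : Set (Rn n)), q x * ψ x =
      -∫ x in (Ω : Set (Rn n)), inner ℝ (v x) ((∇ ψ : Rn n → Rn n) x)

section Aux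

variable {n : ℕ} {Ω : Opens (Rn n)}

theorem continuous_gradient (ψ : 𝓓(Ω, ℝ)) : Continuous (∇ ψ : Rn n → Rn n) :=
  (InnerProductSpace.toDual ℝ (Rn n)).symm.continuous.comp
    (ψ.contDiff.continuous_fderiv (by simp))

theorem hasCompactSupport_gradient (ψ : 𝓓(Ω, ℝ)) :
    HasCompactSupport (∇ ψ : Rn n → Rn n) :=
  (ψ.hasCompactSupport.fderiv (𝕜 := ℝ)).comp_left
    (g := (InnerProductSpace.toDual ℝ (Rn n)).symm) (map_zero _)

theorem continuous_divergence (Ψ : 𝓓(Ω, Rn n)) : Continuous (divergence Ψ) := by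
  have h : Continuous (fderiv ℝ Ψ) := Ψ.contDiff.continuous_fderiv (by simp)
  unfold divergence
  fun_prop

theorem hasCompactSupport_divergence (Ψ : 𝓓(Ω, Rn n)) : HasCompactSupport (divergence Ψ) :=
  (Ψ.hasCompactSupport.fderiv (𝕜 := ℝ)).comp_left
    (g := fun L : Rn n →L[ℝ] Rn n => ∑ i, (L (EuclideanSpace.single i 1)) i) (by simp)

theorem memLp_of_compact {F : Type*} [NormedAddCommGroup F] {g : Rn n → F} (hg : Continuous g)
    (hc : HasCompactSupport g) :
    MemLp g 2 ((volume : Measure (Rn n)).restrict (Ω : Set (Rn n))) :=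
  (hg.memLp_of_hasCompactSupport hc).restrict _

theorem integrable_inner {F : Type*} [NormedAddCommGroup F] [InnerProductSpace ℝ F]
    (f : Lp F 2 ((volume : Measure (Rn n)).restrict (Ω : Set (Rn n)))) {g : Rn n → F}
    (hg : Continuous g) (hc : HasCompactSupport g) :
    Integrable (fun x => inner ℝ (f x) (g x))
      ((volume : Measure (Rn n)).restrict (Ω : Set (Rn n))) :=
  (L2.integrable_inner (𝕜 := ℝ) f ((memLp_of_compact (Ω := Ω) hg hc).toLp g)).congr <| by
    filter_upwards [MemLp.coeFn_toLp (memLp_of_compact (Ω := Ω) hg hc)] with x hx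
    rw [hx]

theorem integral_inner_add {F : Type*} [NormedAddCommGroup F] [InnerProductSpace ℝ F]
    (f f' : Lp F 2 ((volume : Measure (Rn n)).restrict (Ω : Set (Rn n)))) {g : Rn n → F}
    (hg : Continuous g) (hc : HasCompactSupport g) :
    ∫ x in (Ω : Set (Rn n)), inner ℝ ((f + f') x) (g x) =
      (∫ x in (Ω : Set (Rn n)), inner ℝ (f x) (g x)) +
        ∫ x in (Ω : Set (Rn n)), inner ℝ (f' x) (g x) := by
  rw [← integral_add (integrable_inner f hg hc) (integrable_inner f' hg hc)]
  refine integral_congr_ae ?_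
  filter_upwards [Lp.coeFn_add f f'] with x hx
  rw [hx, Pi.add_apply, inner_add_left]

theorem integral_inner_smul {F : Type*} [NormedAddCommGroup F] [InnerProductSpace ℝ F] (c : ℝ)
    (f : Lp F 2 ((volume : Measure (Rn n)).restrict (Ω : Set (Rn n)))) (g : Rn n → F) :
    ∫ x in (Ω : Set (Rn n)), inner ℝ ((c • f) x) (g x) =
      c * ∫ x in (Ω : Set (Rn n)), inner ℝ (f x) (g x) := by
  rw [← integral_const_mul]
  refine integral_congr_ae ?_
  filter_upwards [Lp.coeFn_smul c f] with x hx
  rw [hx, Pi.smul_apply, real_inner_smul_left]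

theorem integral_mul_eq_inner (f : L2 Ω) (g : Rn n → ℝ) :
    ∫ x in (Ω : Set (Rn n)), f x * g x = ∫ x in (Ω : Set (Rn n)), inner ℝ (f x) (g x) := by
  refine integral_congr_ae (.of_forall fun x => ?_)
  simp [mul_comm]

theorem integral_inner_zero {F : Type*} [NormedAddCommGroup F] [InnerProductSpace ℝ F]
    (g : Rn n → F) :
    ∫ x in (Ω : Set (Rn n)),
      inner ℝ ((0 : Lp F 2 ((volume : Measure (Rn n)).restrict (Ω : Set (Rn n)))) x) (g x) = 0 := by
  simpa using integral_inner_smul (Ω := Ω) 0 (0 : Lp F 2 _) g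

end Aux

/-- The Sobolev space `H¹(Ω)`: each `f ∈ L²(Ω)` with weak gradient in `L²(Ω)ⁿ` is recorded together
with its (unique) weak gradient, as the pair `(f, ∇f)`. The norm inherited from the ambient Hilbert
space is the `H¹` norm. -/
noncomputable def H1 {n : ℕ} (Ω : Opens (Rn n)) : Submodule ℝ (ScalarPair Ω) where
  carrier := {p | HasWeakGradient p.fst p.snd}
  zero_mem' := fun Ψ => by
    rw [integral_mul_eq_inner]
    simp only [WithLp.zero_fst, WithLp.zero_snd, integral_inner_zero, neg_zero]
  add_mem' := fun {p q} hp hq Ψ => by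
    have h1 := hp Ψ
    have h2 := hq Ψ
    rw [integral_mul_eq_inner] at h1 h2 ⊢
    rw [WithLp.add_fst, WithLp.add_snd,
      integral_inner_add _ _ Ψ.continuous Ψ.hasCompactSupport,
      integral_inner_add _ _ (continuous_divergence Ψ) (hasCompactSupport_divergence Ψ), h1, h2]
    ring
  smul_mem' := fun c p hp Ψ => by
    have h1 := hp Ψ
    rw [integral_mul_eq_inner] at h1 ⊢
    rw [WithLp.smul_fst, WithLp.smul_snd, integral_inner_smul, integral_inner_smul, h1]
    ring

/-- The space `H(div; Ω)`: each `v ∈ L²(Ω)ⁿ` with weak divergence in `L²(Ω)` is recorded together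
with its (unique) weak divergence, as the pair `(v, div v)`. The norm inherited from the ambient
Hilbert space is the `H(div)` norm. -/
noncomputable def HDiv {n : ℕ} (Ω : Opens (Rn n)) : Submodule ℝ (VectorPair Ω) where
  carrier := {p | HasWeakDivergence p.fst p.snd}
  zero_mem' := fun ψ => by
    rw [integral_mul_eq_inner]
    simp only [WithLp.zero_fst, WithLp.zero_snd, integral_inner_zero, neg_zero]
  add_mem' := fun {p q} hp hq ψ => by
    have h1 := hp ψ
    have h2 := hq ψ
    rw [integral_mul_eq_inner] at h1 h2 ⊢
    rw [WithLp.add_fst, WithLp.add_snd,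
      integral_inner_add _ _ ψ.continuous ψ.hasCompactSupport,
      integral_inner_add _ _ (continuous_gradient ψ) (hasCompactSupport_gradient ψ), h1, h2]
    ring
  smul_mem' := fun c p hp ψ => by
    have h1 := hp ψ
    rw [integral_mul_eq_inner] at h1 ⊢
    rw [WithLp.smul_fst, WithLp.smul_snd, integral_inner_smul, integral_inner_smul, h1]
    ring

/-- The pair `(ψ, ∇ψ)` in `L²(Ω) × L²(Ω)ⁿ` of a test function `ψ ∈ C_c^∞(Ω)`. -/
noncomputable def testScalar {n : ℕ} {Ω : Opens (Rn n)} (ψ : 𝓓(Ω, ℝ)) : ScalarPair Ω :=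
  WithLp.toLp 2
    ((memLp_of_compact ψ.continuous ψ.hasCompactSupport).toLp (ψ : Rn n → ℝ),
      (memLp_of_compact (continuous_gradient ψ) (hasCompactSupport_gradient ψ)).toLp
        (∇ ψ : Rn n → Rn n))

/-- The pair `(Ψ, div Ψ)` in `L²(Ω)ⁿ × L²(Ω)` of a test field `Ψ ∈ C_c^∞(Ω)ⁿ`. -/
noncomputable def testVector {n : ℕ} {Ω : Opens (Rn n)} (Ψ : 𝓓(Ω, Rn n)) : VectorPair Ω :=
  WithLp.toLp 2
    ((memLp_of_compact Ψ.continuous Ψ.hasCompactSupport).toLp (Ψ : Rn n → Rn n),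
      (memLp_of_compact (continuous_divergence Ψ) (hasCompactSupport_divergence Ψ)).toLp
        (divergence Ψ))

/-- `H¹₀(Ω)`, the closure of `C_c^∞(Ω)` in the `H¹` norm (the test functions already form a linear
subspace, so that taking the span adds nothing). -/
noncomputable def H10 {n : ℕ} (Ω : Opens (Rn n)) : Submodule ℝ (ScalarPair Ω) :=
  (Submodule.span ℝ (Set.range (testScalar (Ω := Ω)))).topologicalClosure

/-- `H₀(div; Ω)`, the closure of `C_c^∞(Ω)ⁿ` in the `H(div)` norm. -/
noncomputable def HDiv0 {n : ℕ} (Ω : Opens (Rn n)) : Submodule ℝ (VectorPair Ω) :=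
  (Submodule.span ℝ (Set.range (testVector (Ω := Ω)))).topologicalClosure

/-- The image `∇(V) ⊆ L²(Ω)ⁿ` of a space `V` of pairs `(f, ∇f)`. -/
noncomputable def gradImage {n : ℕ} {Ω : Opens (Rn n)} (V : Submodule ℝ (ScalarPair Ω)) :
    Submodule ℝ (L2Vec Ω) :=
  V.map (WithLp.sndₗ 2 ℝ (L2 Ω) (L2Vec Ω))

/-- `Ker(div) = {v ∈ H(div; Ω) : div v = 0}`, as a subspace of `L²(Ω)ⁿ`. -/
noncomputable def kerDiv {n : ℕ} (Ω : Opens (Rn n)) : Submodule ℝ (L2Vec Ω) :=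
  (HDiv Ω ⊓ LinearMap.ker (WithLp.sndₗ 2 ℝ (L2Vec Ω) (L2 Ω))).map
    (WithLp.fstₗ 2 ℝ (L2Vec Ω) (L2 Ω))

/-- `Ker(div)₀ = Ker(div) ∩ H₀(div; Ω)`, as a subspace of `L²(Ω)ⁿ`. -/
noncomputable def kerDivZero {n : ℕ} (Ω : Opens (Rn n)) : Submodule ℝ (L2Vec Ω) :=
  (HDiv Ω ⊓ LinearMap.ker (WithLp.sndₗ 2 ℝ (L2Vec Ω) (L2 Ω)) ⊓ HDiv0 Ω).map
    (WithLp.fstₗ 2 ℝ (L2Vec Ω) (L2 Ω))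

/-- The trace space `H^{1/2}(∂Ω)`: traces of `H¹` functions, two functions having the same trace
when they differ by an element of `H¹₀(Ω)`; it carries the quotient topology. -/
abbrev TraceSpace {n : ℕ} (Ω : Opens (Rn n)) : Type :=
  H1 Ω ⧸ (H10 Ω).submoduleOf (H1 Ω)

/-- For `p = (v, div v)`, the functional `(f, ∇f) ↦ ∫_Ω v · ∇f + ∫_Ω f div v`. -/
noncomputable def greenForm {n : ℕ} {Ω : Opens (Rn n)} (p : VectorPair Ω) :
    ScalarPair Ω →L[ℝ] ℝ :=
  (innerSL ℝ p.fst).comp (WithLp.sndL 2 ℝ (L2 Ω) (L2Vec Ω)) +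
    (innerSL ℝ p.snd).comp (WithLp.fstL 2 ℝ (L2 Ω) (L2Vec Ω))

theorem greenForm_apply {n : ℕ} {Ω : Opens (Rn n)} (p : VectorPair Ω) (f : ScalarPair Ω) :
    greenForm p f = inner ℝ p.fst f.snd + inner ℝ p.snd f.fst := rfl

theorem H10_le_ker_greenForm {n : ℕ} {Ω : Opens (Rn n)} (p : HDiv Ω) :
    H10 Ω ≤ LinearMap.ker (greenForm (p : VectorPair Ω)).toLinearMap := by
  refine Submodule.topologicalClosure_minimal _ ?_
    (ContinuousLinearMap.isClosed_ker (greenForm (p : VectorPair Ω)))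
  rw [Submodule.span_le]
  rintro _ ⟨ψ, rfl⟩
  have h := p.2 ψ
  rw [integral_mul_eq_inner] at h
  change greenForm (p : VectorPair Ω) (testScalar ψ) = 0
  rw [greenForm_apply, L2.inner_def, L2.inner_def]
  have e1 : ∫ x in (Ω : Set (Rn n)), inner ℝ ((p : VectorPair Ω).fst x) ((testScalar ψ).snd x) =
      ∫ x in (Ω : Set (Rn n)), inner ℝ ((p : VectorPair Ω).fst x) ((∇ ψ : Rn n → Rn n) x) := by
    refine integral_congr_ae ?_
    filter_upwards [MemLp.coeFn_toLp (memLp_of_compact (Ω := Ω) (continuous_gradient ψ)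
      (hasCompactSupport_gradient ψ))] with x hx
    exact congrArg _ hx
  have e2 : ∫ x in (Ω : Set (Rn n)), inner ℝ ((p : VectorPair Ω).snd x) ((testScalar ψ).fst x) =
      ∫ x in (Ω : Set (Rn n)), inner ℝ ((p : VectorPair Ω).snd x) (ψ x) := by
    refine integral_congr_ae ?_
    filter_upwards [MemLp.coeFn_toLp (memLp_of_compact (Ω := Ω) ψ.continuous
      ψ.hasCompactSupport)] with x hx
    exact congrArg _ hx
  rw [e1, e2, h]
  ring

/-- The normal trace `v · n ∈ H^{-1/2}(∂Ω) = (H^{1/2}(∂Ω))'` of a field `v ∈ H(div; Ω)`, defined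
by Green's formula `⟨v · n, f|_∂Ω⟩ = ∫_Ω v · ∇f + ∫_Ω f div v` for `f ∈ H¹(Ω)`. -/
noncomputable def normalTrace {n : ℕ} {Ω : Opens (Rn n)} (p : HDiv Ω) : TraceSpace Ω →L[ℝ] ℝ :=
  ((H10 Ω).submoduleOf (H1 Ω)).liftQL ((greenForm (p : VectorPair Ω)).comp (H1 Ω).subtypeL)
    (fun _ hf => H10_le_ker_greenForm p (Submodule.mem_comap.1 hf))

/-- `L²(Ω)ⁿ = U ⊕ W`, a direct sum with `U` and `W` orthogonal in `L²(Ω)ⁿ`. -/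
def IsOrthogonalDirectSum {n : ℕ} {Ω : Opens (Rn n)} (U W : Submodule ℝ (L2Vec Ω)) : Prop :=
  IsCompl U W ∧ ∀ u ∈ U, ∀ w ∈ W, inner ℝ u w = 0

/-- `φ ∈ V` and `∫_Ω ∇φ · ∇ψ = ∫_Ω f · ∇ψ` for all `ψ ∈ V`. For `V = H¹₀(Ω)` this is the
homogeneous Dirichlet problem for `Δφ = div f`, for `V = H¹(Ω)` the homogeneous Neumann problem. -/
def SolvesVariational {n : ℕ} {Ω : Opens (Rn n)} (V : Submodule ℝ (ScalarPair Ω)) (f : L2Vec Ω)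
    (φ : ScalarPair Ω) : Prop :=
  φ ∈ V ∧ ∀ ψ ∈ V, inner ℝ φ.snd ψ.snd = inner ℝ f ψ.snd

end Helmholtz

namespace Helmholtz

/-! ### Weak derivatives as orthogonality relations. -/

section Formal

variable {n : ℕ} {Ω : Opens (Rn n)}

/-! The theorem splits into duality, which needs no regularity of the boundary, and closedness of
two spaces of gradients.

Duality: `Ker(div)` is the orthogonal complement of `∇H¹₀` almost by definition. For `Ker(div)₀`,
exchanging the components of the pairs `(f, ∇f)` turns `H¹` into the orthogonal complement of the
test pairs `(Ψ, div Ψ)`. Since a double orthogonal complement is a closure, `H₀(div)` is the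
annihilator of `H¹` (`mem_HDiv0_iff`), whence `Ker(div)₀ = (∇H¹)ᗮ`. Once the gradients form a closed
subspace, orthogonal projection gives the decompositions and solves the variational problems.

Closedness: for `∇H¹₀` it follows from the Poincaré inequality on a bounded set. For `∇H¹` a
Poincaré inequality under finitely many linear constraints suffices, and neither connectedness nor
Rellich's theorem is needed. By `HasLipschitzBoundary.exists_visible_ball` and compactness, `Ω` is
covered by finitely many pieces, each of which sees a whole ball of `Ω` along segments. If the
integral of `f` over that ball vanishes, the translation estimate `lintegral_translate_sub_le`
bounds `f` on the piece by `∇f`. The constraints cut out a subspace of finite codimension, so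
closedness passes to all of `∇H¹`. -/

theorem inner_gradient (ψ : Rn n → ℝ) (x v : Rn n) :
    inner ℝ ((∇ ψ : Rn n → Rn n) x) v = fderiv ℝ ψ x v := by
  rw [gradient, InnerProductSpace.toDual_symm_apply]

theorem inner_toLp {F : Type*} [NormedAddCommGroup F] [InnerProductSpace ℝ F]
    {μ : Measure (Rn n)} (f : Lp F 2 μ) {g : Rn n → F} (hg : MemLp g 2 μ) :
    inner ℝ f (hg.toLp g) = ∫ x, inner ℝ (f x) (g x) ∂μ := by
  rw [L2.inner_def]
  refine integral_congr_ae ?_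
  filter_upwards [MemLp.coeFn_toLp hg] with x hx
  rw [hx]

theorem memLp_testFunction {F : Type*} [NormedAddCommGroup F] [NormedSpace ℝ F] (Ψ : 𝓓(Ω, F)) :
    MemLp Ψ 2 ((volume : Measure (Rn n)).restrict (Ω : Set (Rn n))) :=
  memLp_of_compact Ψ.continuous Ψ.hasCompactSupport

theorem memLp_gradient (ψ : 𝓓(Ω, ℝ)) :
    MemLp (∇ ψ : Rn n → Rn n) 2 ((volume : Measure (Rn n)).restrict (Ω : Set (Rn n))) :=
  memLp_of_compact (continuous_gradient ψ) (hasCompactSupport_gradient ψ)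

theorem memLp_divergence (Ψ : 𝓓(Ω, Rn n)) :
    MemLp (divergence Ψ) 2 ((volume : Measure (Rn n)).restrict (Ω : Set (Rn n))) :=
  memLp_of_compact (continuous_divergence Ψ) (hasCompactSupport_divergence Ψ)

theorem inner_testVector_fst (F : L2Vec Ω) (Ψ : 𝓓(Ω, Rn n)) :
    inner ℝ F (testVector Ψ).fst = ∫ x in (Ω : Set (Rn n)), inner ℝ (F x) (Ψ x) :=
  inner_toLp F (memLp_testFunction Ψ)

theorem inner_testVector_snd (f : L2 Ω) (Ψ : 𝓓(Ω, Rn n)) :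
    inner ℝ f (testVector Ψ).snd = ∫ x in (Ω : Set (Rn n)), inner ℝ (f x) (divergence Ψ x) :=
  inner_toLp f (memLp_divergence Ψ)

theorem inner_testScalar_fst (f : L2 Ω) (ψ : 𝓓(Ω, ℝ)) :
    inner ℝ f (testScalar ψ).fst = ∫ x in (Ω : Set (Rn n)), inner ℝ (f x) (ψ x) :=
  inner_toLp f (memLp_testFunction ψ)

theorem inner_testScalar_snd (F : L2Vec Ω) (ψ : 𝓓(Ω, ℝ)) :
    inner ℝ F (testScalar ψ).snd =
      ∫ x in (Ω : Set (Rn n)), inner ℝ (F x) ((∇ ψ : Rn n → Rn n) x) :=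
  inner_toLp F (memLp_gradient ψ)

theorem hasWeakGradient_iff (f : L2 Ω) (F : L2Vec Ω) :
    HasWeakGradient f F ↔
      ∀ Ψ : 𝓓(Ω, Rn n), inner ℝ F (testVector Ψ).fst + inner ℝ f (testVector Ψ).snd = 0 := by
  refine forall_congr' fun Ψ => ?_
  rw [integral_mul_eq_inner, inner_testVector_fst, inner_testVector_snd, eq_neg_iff_add_eq_zero]

theorem hasWeakDivergence_iff (v : L2Vec Ω) (q : L2 Ω) :
    HasWeakDivergence v q ↔
      ∀ ψ : 𝓓(Ω, ℝ), inner ℝ q (testScalar ψ).fst + inner ℝ v (testScalar ψ).snd = 0 := by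
  refine forall_congr' fun Ψ => ?_
  rw [integral_mul_eq_inner, inner_testScalar_fst, inner_testScalar_snd, eq_neg_iff_add_eq_zero]

/-- The weak gradient identity is orthogonality to each test pair `(Ψ, div Ψ)`; the swap places the
gradient opposite `Ψ` and the function opposite `div Ψ`. This gives closedness of `H1` and drives
`mem_HDiv0_iff`. -/
theorem mem_H1_iff_swap_mem_orthogonal (p : ScalarPair Ω) :
    p ∈ H1 Ω ↔ WithLp.toLp 2 (p.snd, p.fst) ∈
      (Submodule.span ℝ (Set.range (testVector (Ω := Ω))))ᗮ := by
  rw [Submodule.mem_orthogonal']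
  refine (hasWeakGradient_iff _ _).trans ⟨fun h u hu => ?_, fun h Ψ => ?_⟩
  · induction hu using Submodule.span_induction with
    | mem u hu =>
      obtain ⟨Ψ, rfl⟩ := hu
      rw [WithLp.prod_inner_apply]
      exact h Ψ
    | zero => simp
    | add u v _ _ hu hv => rw [inner_add_right, hu, hv, add_zero]
    | smul c u _ hu => rw [inner_smul_right, hu, mul_zero]
  · have := h _ (Submodule.subset_span ⟨Ψ, rfl⟩)
    rwa [WithLp.prod_inner_apply] at this

theorem isClosed_H1 : IsClosed (H1 Ω : Set (ScalarPair Ω)) := by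
  have : (H1 Ω : Set (ScalarPair Ω)) =
      (fun p : ScalarPair Ω => (WithLp.toLp 2 (p.snd, p.fst) : VectorPair Ω)) ⁻¹'
        ((Submodule.span ℝ (Set.range (testVector (Ω := Ω))))ᗮ : Submodule ℝ (VectorPair Ω)) :=
    Set.ext fun p => mem_H1_iff_swap_mem_orthogonal p
  rw [this]
  exact (Submodule.isClosed_orthogonal _).preimage (by fun_prop)

theorem contDiff_component (Ψ : 𝓓(Ω, Rn n)) (i : Fin n) : ContDiff ℝ 1 fun x => Ψ x i := by
  have h : ContDiff ℝ 1 Ψ := Ψ.contDiff.of_le (by simp)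
  fun_prop

theorem fderiv_component (Ψ : 𝓓(Ω, Rn n)) (i : Fin n) (x v : Rn n) :
    fderiv ℝ (fun x => Ψ x i) x v = (fderiv ℝ Ψ x v) i := by
  have h : DifferentiableAt ℝ Ψ x := Ψ.contDiff.differentiable (by simp) x
  have := ((EuclideanSpace.proj (𝕜 := ℝ) i).hasFDerivAt.comp x h.hasFDerivAt).fderiv
  exact congrArg (fun L : Rn n →L[ℝ] ℝ => L v) this

/-- Coordinatewise integration by parts on the whole space; compact supports provide integrability
and remove boundary terms. -/
theorem integral_inner_gradient_eq_neg (ψ : 𝓓(Ω, ℝ)) (Ψ : 𝓓(Ω, Rn n)) :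
    ∫ x, inner ℝ ((∇ ψ : Rn n → Rn n) x) (Ψ x) = -∫ x, ψ x * divergence Ψ x := by
  have hψ : Continuous (fderiv ℝ ψ) := ψ.contDiff.continuous_fderiv (by simp)
  have hi : ∀ i : Fin n, Integrable fun x => fderiv ℝ ψ x (EuclideanSpace.single i 1) * Ψ x i := by
    intro i
    refine Continuous.integrable_of_hasCompactSupport ?_ ?_
    · have := (contDiff_component Ψ i).continuous
      fun_prop
    · exact (ψ.hasCompactSupport.fderiv_apply (𝕜 := ℝ) _).mul_right
  have hi' : ∀ i : Fin n,
      Integrable fun x => ψ x * fderiv ℝ (fun x => Ψ x i) x (EuclideanSpace.single i 1) := by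
    intro i
    refine Continuous.integrable_of_hasCompactSupport ?_ ψ.hasCompactSupport.mul_right
    have := (contDiff_component Ψ i).continuous_fderiv (by simp)
    fun_prop
  have e1 : ∀ x, inner ℝ ((∇ ψ : Rn n → Rn n) x) (Ψ x) =
      ∑ i, fderiv ℝ ψ x (EuclideanSpace.single i 1) * Ψ x i := by
    intro x
    rw [inner_gradient]
    conv_lhs => rw [← (EuclideanSpace.basisFun (Fin n) ℝ).sum_repr (Ψ x)]
    simp [mul_comm]
  have e2 : ∀ x, ψ x * divergence Ψ x =
      ∑ i, ψ x * fderiv ℝ (fun x => Ψ x i) x (EuclideanSpace.single i 1) := by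
    intro x
    simp only [divergence, Finset.mul_sum, fderiv_component]
  simp only [e1, e2]
  rw [integral_finsetSum _ fun i _ => hi i, integral_finsetSum _ fun i _ => hi' i,
    ← Finset.sum_neg_distrib]
  refine Finset.sum_congr rfl fun i _ => ?_
  rw [integral_mul_fderiv_eq_neg_fderiv_mul_of_integrable (hi i) (hi' i) ?_
    (fun x _ => ψ.contDiff.differentiable (by simp) x)
    (fun x _ => (contDiff_component Ψ i).differentiable (by simp) x), neg_neg]
  exact Continuous.integrable_of_hasCompactSupport
    (ψ.continuous.mul (contDiff_component Ψ i).continuous) ψ.hasCompactSupport.mul_right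

theorem testScalar_mem_H1 (ψ : 𝓓(Ω, ℝ)) : testScalar ψ ∈ H1 Ω := by
  refine (hasWeakGradient_iff _ _).2 fun Ψ => ?_
  rw [real_inner_comm (testVector Ψ).fst, real_inner_comm (testVector Ψ).snd,
    inner_testScalar_fst, inner_testScalar_snd]
  have e1 : ∫ x in (Ω : Set (Rn n)), inner ℝ ((testVector Ψ).fst x) ((∇ ψ : Rn n → Rn n) x) =
      ∫ x in (Ω : Set (Rn n)), inner ℝ ((∇ ψ : Rn n → Rn n) x) (Ψ x) := by
    refine integral_congr_ae ?_
    filter_upwards [MemLp.coeFn_toLp (memLp_of_compact (Ω := Ω) Ψ.continuous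
      Ψ.hasCompactSupport)] with x hx
    rw [real_inner_comm]
    exact congrArg _ hx
  have e2 : ∫ x in (Ω : Set (Rn n)), inner ℝ ((testVector Ψ).snd x) (ψ x) =
      ∫ x in (Ω : Set (Rn n)), ψ x * divergence Ψ x := by
    refine integral_congr_ae ?_
    filter_upwards [MemLp.coeFn_toLp (memLp_of_compact (Ω := Ω) (continuous_divergence Ψ)
      (hasCompactSupport_divergence Ψ))] with x hx
    exact congrArg (fun y => ψ x * y) hx
  rw [e1, e2, setIntegral_eq_integral_of_forall_compl_eq_zero,
    setIntegral_eq_integral_of_forall_compl_eq_zero, integral_inner_gradient_eq_neg,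
    neg_add_cancel]
  · intro x hx
    rw [image_eq_zero_of_notMem_tsupport fun h => hx (ψ.tsupport_subset h), zero_mul]
  · intro x hx
    rw [image_eq_zero_of_notMem_tsupport fun h => hx (Ψ.tsupport_subset h), inner_zero_right]

theorem H10_le_H1 : H10 Ω ≤ H1 Ω := by
  refine Submodule.topologicalClosure_minimal _ ?_ isClosed_H1
  rw [Submodule.span_le]
  rintro _ ⟨ψ, rfl⟩
  exact testScalar_mem_H1 ψ

/-! ### Orthogonal complements of gradients and the normal trace. -/

theorem mem_gradImage {V : Submodule ℝ (ScalarPair Ω)} {u : L2Vec Ω} :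
    u ∈ gradImage V ↔ ∃ φ ∈ V, φ.snd = u := Iff.rfl

theorem mem_gradImage_orthogonal {V : Submodule ℝ (ScalarPair Ω)} {v : L2Vec Ω} :
    v ∈ (gradImage V)ᗮ ↔ ∀ φ ∈ V, inner ℝ v φ.snd = 0 := by
  rw [Submodule.mem_orthogonal']
  exact ⟨fun h φ hφ => h _ ⟨φ, hφ, rfl⟩, fun h _ ⟨φ, hφ, e⟩ => e ▸ h φ hφ⟩

theorem mem_kerDiv {v : L2Vec Ω} : v ∈ kerDiv Ω ↔ HasWeakDivergence v 0 := by
  constructor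
  · rintro ⟨p, ⟨hp, hp0⟩, rfl⟩
    have hp0 : p.snd = 0 := hp0
    have hp : HasWeakDivergence p.fst p.snd := hp
    rwa [hp0] at hp
  · intro h
    exact ⟨WithLp.toLp 2 (v, 0), ⟨h, rfl⟩, rfl⟩

/-- A vanishing weak divergence is orthogonality to gradients of test functions; continuity of the
Green form extends it to their `H¹` closure. -/
theorem kerDiv_eq_orthogonal : kerDiv Ω = (gradImage (H10 Ω))ᗮ := by
  ext v
  rw [mem_kerDiv, mem_gradImage_orthogonal]
  constructor
  · intro h φ hφ
    have := H10_le_ker_greenForm (⟨WithLp.toLp 2 (v, 0), h⟩ : HDiv Ω) hφ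
    have : greenForm (WithLp.toLp 2 (v, 0)) φ = 0 := this
    rw [greenForm_apply] at this
    simpa using this
  · intro h
    refine (hasWeakDivergence_iff _ _).2 fun ψ => ?_
    rw [inner_zero_left, zero_add]
    exact h _ (Submodule.le_topologicalClosure _ (Submodule.subset_span ⟨ψ, rfl⟩))

/-- The closure of the test pairs is their double orthogonal complement, and the first complement is
`H1` with components swapped. Thus no trace theorem or density result near the boundary is required.
-/
theorem mem_HDiv0_iff (v : L2Vec Ω) (q : L2 Ω) :
    WithLp.toLp 2 (v, q) ∈ HDiv0 Ω ↔ ∀ φ ∈ H1 Ω, inner ℝ v φ.snd + inner ℝ q φ.fst = 0 := by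
  rw [HDiv0, ← Submodule.orthogonal_orthogonal_eq_closure, Submodule.mem_orthogonal']
  constructor
  · intro h φ hφ
    have := h _ ((mem_H1_iff_swap_mem_orthogonal φ).1 hφ)
    rwa [WithLp.prod_inner_apply] at this
  · intro h u hu
    rw [WithLp.prod_inner_apply]
    exact h (WithLp.toLp 2 (u.snd, u.fst)) ((mem_H1_iff_swap_mem_orthogonal _).2 hu)

theorem kerDivZero_eq_orthogonal : kerDivZero Ω = (gradImage (H1 Ω))ᗮ := by
  ext v
  rw [mem_gradImage_orthogonal]
  constructor
  · rintro ⟨p, ⟨⟨-, hp0⟩, hp⟩, rfl⟩ φ hφ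
    have hp0 : p.snd = 0 := hp0
    have := (mem_HDiv0_iff p.fst p.snd).1 hp φ hφ
    rw [hp0, inner_zero_left, add_zero] at this
    exact this
  · intro h
    refine ⟨WithLp.toLp 2 (v, 0), ⟨⟨?_, rfl⟩, ?_⟩, rfl⟩
    -- Orthogonality to `∇H¹` contains orthogonality to `∇H¹₀`, so the divergence vanishes.
    · refine mem_kerDiv.1 ?_
      rw [kerDiv_eq_orthogonal, mem_gradImage_orthogonal]
      exact fun φ hφ => h φ (H10_le_H1 hφ)
    · refine (mem_HDiv0_iff _ _).2 fun φ hφ => ?_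
      rw [h φ hφ, inner_zero_left, add_zero]

theorem normalTrace_eq_zero_iff (p : HDiv Ω) :
    normalTrace p = 0 ↔ ∀ φ ∈ H1 Ω, greenForm (p : VectorPair Ω) φ = 0 := by
  constructor
  · intro h φ hφ
    exact congrArg (fun L : TraceSpace Ω →L[ℝ] ℝ => L (Submodule.Quotient.mk ⟨φ, hφ⟩)) h
  · intro h
    ext x
    obtain ⟨φ, rfl⟩ := Submodule.Quotient.mk_surjective _ x
    exact h φ φ.2

theorem mem_kerDivZero_iff_normalTrace (v : L2Vec Ω) :
    v ∈ kerDivZero Ω ↔ ∃ p : HDiv Ω, (p : VectorPair Ω).fst = v ∧ (p : VectorPair Ω).snd = 0 ∧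
      normalTrace p = 0 := by
  constructor
  · intro hv
    have hv' := hv
    rw [kerDivZero_eq_orthogonal, mem_gradImage_orthogonal] at hv'
    obtain ⟨p, ⟨⟨hp, hp0⟩, -⟩, rfl⟩ := hv
    have hp0 : p.snd = 0 := hp0
    refine ⟨⟨p, hp⟩, rfl, hp0, (normalTrace_eq_zero_iff _).2 fun φ hφ => ?_⟩
    rw [greenForm_apply, hp0, inner_zero_left, add_zero]
    exact hv' φ hφ
  · rintro ⟨p, rfl, hp0, hp⟩
    rw [kerDivZero_eq_orthogonal, mem_gradImage_orthogonal]
    intro φ hφ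
    have := (normalTrace_eq_zero_iff p).1 hp φ hφ
    rwa [greenForm_apply, hp0, inner_zero_left, add_zero] at this

/-! ### Variational problems and closed spaces of gradients. -/

theorem isOrthogonalDirectSum_orthogonal {U : Submodule ℝ (L2Vec Ω)}
    (hU : IsClosed (U : Set (L2Vec Ω))) : IsOrthogonalDirectSum U Uᗮ := by
  have : CompleteSpace U := hU.completeSpace_coe
  exact ⟨U.isCompl_orthogonal,
    fun u hu w hw => Submodule.inner_right_of_mem_orthogonal hu hw⟩

theorem solvesVariational_iff {V : Submodule ℝ (ScalarPair Ω)} {f : L2Vec Ω}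
    {φ : ScalarPair Ω} :
    SolvesVariational V f φ ↔ φ ∈ V ∧ f - φ.snd ∈ (gradImage V)ᗮ := by
  refine and_congr_right fun _ => ?_
  rw [mem_gradImage_orthogonal]
  refine forall₂_congr fun ψ _ => ?_
  rw [inner_sub_left, sub_eq_zero, eq_comm]

/-- The projection of `f` onto the closed space of gradients is itself a gradient, and any potential
of it is a solution. -/
theorem exists_solvesVariational {V : Submodule ℝ (ScalarPair Ω)}
    (hV : IsClosed (gradImage V : Set (L2Vec Ω))) (f : L2Vec Ω) :
    ∃ φ, SolvesVariational V f φ := by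
  have : CompleteSpace (gradImage V) := hV.completeSpace_coe
  obtain ⟨φ, hφ, e⟩ := mem_gradImage.1 ((gradImage V).starProjection_apply_mem f)
  refine ⟨φ, solvesVariational_iff.2 ⟨hφ, ?_⟩⟩
  rw [e]
  exact Submodule.sub_starProjection_mem_orthogonal f

theorem SolvesVariational.snd_eq {V : Submodule ℝ (ScalarPair Ω)} {f : L2Vec Ω}
    {φ φ' : ScalarPair Ω} (h : SolvesVariational V f φ) (h' : SolvesVariational V f φ') :
    φ.snd = φ'.snd := by
  have hd : (φ - φ').snd = φ.snd - φ'.snd := rfl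
  have hm := V.sub_mem h.1 h'.1
  have h0 : inner ℝ (φ.snd - φ'.snd) (φ - φ').snd = 0 := by
    rw [inner_sub_left, h.2 _ hm, h'.2 _ hm, sub_self]
  rw [hd] at h0
  exact sub_eq_zero.1 (inner_self_eq_zero.1 h0)

/-- A closed space of pairs on which `‖f‖ ≤ C ‖∇f‖` has a closed space of gradients. -/
theorem isClosed_gradImage_of_bound {V : Submodule ℝ (ScalarPair Ω)}
    (hV : IsClosed (V : Set (ScalarPair Ω))) {C : ℝ} (hC : ∀ φ ∈ V, ‖φ.fst‖ ≤ C * ‖φ.snd‖) :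
    IsClosed (gradImage V : Set (L2Vec Ω)) := by
  have : CompleteSpace V := hV.completeSpace_coe
  let T : V →L[ℝ] L2Vec Ω := (WithLp.sndL 2 ℝ (L2 Ω) (L2Vec Ω)).comp V.subtypeL
  -- Since `(|C| + 1)² ≥ C² + 1`, this constant controls both components of the norm; the absolute
  -- value covers a negative `C`.
  have hT : ∀ φ : V, ‖φ‖ ≤ (Real.toNNReal (|C| + 1) : NNReal) * ‖T φ‖ := by
    intro φ
    rw [Real.coe_toNNReal _ (by positivity)]
    have h1 := hC φ φ.2
    have h2 : ‖(φ : ScalarPair Ω)‖ ^ 2 =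
        ‖(φ : ScalarPair Ω).fst‖ ^ 2 + ‖(φ : ScalarPair Ω).snd‖ ^ 2 :=
      WithLp.prod_norm_sq_eq_of_L2 _
    change ‖(φ : ScalarPair Ω)‖ ≤ (|C| + 1) * ‖(φ : ScalarPair Ω).snd‖
    have h3 : ‖(φ : ScalarPair Ω).fst‖ ≤ |C| * ‖(φ : ScalarPair Ω).snd‖ :=
      h1.trans (by gcongr; exact le_abs_self C)
    refine abs_le_of_sq_le_sq' ?_ (by positivity) |>.2
    rw [h2]
    have h4 : ‖(φ : ScalarPair Ω).fst‖ ^ 2 ≤ (|C| * ‖(φ : ScalarPair Ω).snd‖) ^ 2 := by gcongr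
    have h5 : 0 ≤ |C| * ‖(φ : ScalarPair Ω).snd‖ ^ 2 := by positivity
    nlinarith
  have := (T.antilipschitz_of_bound hT).isClosed_range T.uniformContinuous
  convert this using 1
  ext u
  constructor
  · rintro ⟨φ, hφ, rfl⟩
    exact ⟨⟨φ, hφ⟩, rfl⟩
  · rintro ⟨φ, rfl⟩
    exact ⟨φ, φ.2, rfl⟩

/-- If `‖f‖ ≤ C ‖∇f‖` holds in a closed space of pairs under finitely many linear constraints,
then the space has a closed space of gradients. -/
theorem isClosed_gradImage_of_bound_of_constraints {V : Submodule ℝ (ScalarPair Ω)}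
    (hV : IsClosed (V : Set (ScalarPair Ω))) {ι : Type*} [Finite ι]
    (ℓ : ι → ScalarPair Ω →L[ℝ] ℝ) {C : ℝ}
    (hC : ∀ φ ∈ V, (∀ i, ℓ i φ = 0) → ‖φ.fst‖ ≤ C * ‖φ.snd‖) :
    IsClosed (gradImage V : Set (L2Vec Ω)) := by
  let K : ScalarPair Ω →L[ℝ] (ι → ℝ) := ContinuousLinearMap.pi ℓ
  have hK : IsClosed (gradImage (V ⊓ LinearMap.ker K.toLinearMap) : Set (L2Vec Ω)) :=
    isClosed_gradImage_of_bound (hV.inter (ContinuousLinearMap.isClosed_ker K))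
      fun φ hφ => hC φ hφ.1 fun i => congrFun hφ.2 i
  let T : V →ₗ[ℝ] L2Vec Ω := (WithLp.sndₗ 2 ℝ (L2 Ω) (L2Vec Ω)).comp V.subtype
  let s : Submodule ℝ V := LinearMap.ker (K.toLinearMap.comp V.subtype)
  -- The quotient is isomorphic to the range of finitely many functionals. The image of `V` is
  -- therefore the closed image of `s` enlarged by a finite-dimensional space.
  have : FiniteDimensional ℝ (V ⧸ s) :=
    (K.toLinearMap.comp V.subtype).quotKerEquivRange.symm.finiteDimensional
  have : s.CoFG := inferInstanceAs (Module.Finite ℝ (V ⧸ s))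
  have h1 : s.map T = gradImage (V ⊓ LinearMap.ker K.toLinearMap) := by
    ext u
    constructor
    · rintro ⟨φ, hφ, rfl⟩
      exact ⟨φ, ⟨φ.2, hφ⟩, rfl⟩
    · rintro ⟨φ, hφ, rfl⟩
      exact ⟨⟨φ, hφ.1⟩, hφ.2, rfl⟩
  have h2 : LinearMap.range T = gradImage V := by
    ext u
    constructor
    · rintro ⟨φ, rfl⟩
      exact ⟨φ, φ.2, rfl⟩
    · rintro ⟨φ, hφ, rfl⟩
      exact ⟨⟨φ, hφ⟩, rfl⟩
  rw [← h2]
  exact LinearMap.isClosed_range_of_isClosed_map_of_finiteDimensional_quotient (s := s)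
    (by rw [h1]; exact hK)

/-! ### The Poincaré inequality on `H10`. -/

theorem testScalar_add (ψ ψ' : 𝓓(Ω, ℝ)) :
    testScalar (ψ + ψ') = testScalar ψ + testScalar ψ' := by
  have e : (∇ (ψ + ψ' : 𝓓(Ω, ℝ)) : Rn n → Rn n) = ∇ ψ + ∇ ψ' := by
    funext x
    refine ext_inner_right ℝ fun v => ?_
    rw [Pi.add_apply, inner_add_left, inner_gradient, inner_gradient, inner_gradient]
    exact congrArg (fun L : Rn n →L[ℝ] ℝ => L v) (fderiv_add
      (ψ.contDiff.differentiable (by simp) x) (ψ'.contDiff.differentiable (by simp) x))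
  have h1 := MemLp.toLp_add (memLp_testFunction ψ) (memLp_testFunction ψ')
  have h2 : (memLp_gradient (ψ + ψ')).toLp _ = (memLp_gradient ψ).toLp _ +
      (memLp_gradient ψ').toLp _ :=
    (MemLp.toLp_congr _ ((memLp_gradient ψ).add (memLp_gradient ψ'))
      (ae_of_all _ fun x => congrFun e x)).trans (MemLp.toLp_add _ _)
  exact congrArg (WithLp.toLp 2) (Prod.ext h1 h2)

theorem testScalar_smul (c : ℝ) (ψ : 𝓓(Ω, ℝ)) : testScalar (c • ψ) = c • testScalar ψ := by
  have e : (∇ (c • ψ : 𝓓(Ω, ℝ)) : Rn n → Rn n) = c • ∇ ψ := by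
    funext x
    refine ext_inner_right ℝ fun v => ?_
    rw [Pi.smul_apply, real_inner_smul_left, inner_gradient, inner_gradient]
    exact congrArg (fun L : Rn n →L[ℝ] ℝ => L v) (fderiv_const_smul
      (ψ.contDiff.differentiable (by simp) x) c)
  have h1 := MemLp.toLp_const_smul c (memLp_testFunction ψ)
  have h2 : (memLp_gradient (c • ψ)).toLp _ = c • (memLp_gradient ψ).toLp _ :=
    (MemLp.toLp_congr _ ((memLp_gradient ψ).const_smul c)
      (ae_of_all _ fun x => congrFun e x)).trans (MemLp.toLp_const_smul c _)
  exact congrArg (WithLp.toLp 2) (Prod.ext h1 h2)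

/-- A norm inequality does not survive span induction, so linearity of `testScalar` is used to write
every element of the span as a single test pair. -/
theorem mem_span_range_testScalar {φ : ScalarPair Ω}
    (hφ : φ ∈ Submodule.span ℝ (Set.range (testScalar (Ω := Ω)))) :
    ∃ ψ : 𝓓(Ω, ℝ), testScalar ψ = φ := by
  induction hφ using Submodule.span_induction with
  | mem u hu => exact hu
  | zero => exact ⟨(0 : ℝ) • 0, by rw [testScalar_smul, zero_smul]⟩
  | add u v _ _ hu hv =>
    obtain ⟨ψ, rfl⟩ := hu
    obtain ⟨ψ', rfl⟩ := hv
    exact ⟨ψ + ψ', testScalar_add ψ ψ'⟩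
  | smul c u _ hu =>
    obtain ⟨ψ, rfl⟩ := hu
    exact ⟨c • ψ, testScalar_smul c ψ⟩

theorem norm_sq_toLp {F : Type*} [NormedAddCommGroup F] [InnerProductSpace ℝ F]
    {μ : Measure (Rn n)} {g : Rn n → F} (hg : MemLp g 2 μ) :
    ‖hg.toLp g‖ ^ 2 = ∫ x, ‖g x‖ ^ 2 ∂μ := by
  rw [← real_inner_self_eq_norm_sq, L2.inner_def]
  refine integral_congr_ae ?_
  filter_upwards [MemLp.coeFn_toLp hg] with x hx
  rw [hx, real_inner_self_eq_norm_sq]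

/-- The Poincaré inequality for test functions on a set contained in a slab. -/
theorem norm_testScalar_fst_le {e : Rn n} (he : ‖e‖ = 1) {R : ℝ} (hR : 0 ≤ R)
    (hΩ : ∀ x ∈ Ω, |inner ℝ e x| ≤ R) (ψ : 𝓓(Ω, ℝ)) :
    ‖(testScalar ψ).fst‖ ≤ 2 * R * ‖(testScalar ψ).snd‖ := by
  have hψ1 : ContDiff ℝ 1 ψ := ψ.contDiff.of_le (by simp)
  have hdψ : Continuous (fderiv ℝ ψ) := hψ1.continuous_fderiv (by simp)
  have hf : ContDiff ℝ 1 fun x : Rn n => inner ℝ e x * ψ x :=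
    (innerSL ℝ e).contDiff.mul hψ1
  have hfd : ∀ x, fderiv ℝ (fun x : Rn n => inner ℝ e x * ψ x) x e =
      ψ x + inner ℝ e x * fderiv ℝ ψ x e := by
    intro x
    have h1 : HasFDerivAt (fun x : Rn n => inner ℝ e x) (innerSL ℝ e) x :=
      (innerSL ℝ e).hasFDerivAt
    have h2 := h1.mul (hψ1.differentiable (by simp) x).hasFDerivAt
    have h3 := congrArg (fun L : Rn n →L[ℝ] ℝ => L e) h2.fderiv
    refine h3.trans ?_
    simp [he]
    ring
  have hi1 : Integrable fun x => ψ x * ψ x :=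
    (by fun_prop : Continuous fun x => ψ x * ψ x).integrable_of_hasCompactSupport
      ψ.hasCompactSupport.mul_right
  have hi2 : Integrable fun x => inner ℝ e x * fderiv ℝ ψ x e * ψ x :=
    (by fun_prop : Continuous fun x => inner ℝ e x * fderiv ℝ ψ x e * ψ x
      ).integrable_of_hasCompactSupport ψ.hasCompactSupport.mul_left
  have hi3 : Integrable fun x => ‖(∇ ψ : Rn n → Rn n) x‖ ^ 2 := by
    refine Continuous.integrable_of_hasCompactSupport ((continuous_gradient ψ).norm.pow 2) ?_
    exact (hasCompactSupport_gradient ψ).comp_left (g := fun v => ‖v‖ ^ 2) (by simp)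
  -- Integrating `⟨e, x⟩ψ` against `∂ₑψ` by parts yields `∫ ψ² = -2 ∫ ⟨e, x⟩ ψ ∂ₑψ`.
  have key := integral_mul_fderiv_eq_neg_fderiv_mul_of_integrable (μ := volume)
    (f := fun x : Rn n => inner ℝ e x * ψ x) (g := ψ) (v := e)
    ((hi1.add hi2).congr (ae_of_all _ fun x => by
      change ψ x * ψ x + inner ℝ e x * fderiv ℝ ψ x e * ψ x =
        fderiv ℝ (fun x : Rn n => inner ℝ e x * ψ x) x e * ψ x
      rw [hfd]; ring))
    (hi2.congr (ae_of_all _ fun x => by ring))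
    ((by fun_prop : Continuous fun x => inner ℝ e x * ψ x * ψ x
      ).integrable_of_hasCompactSupport ψ.hasCompactSupport.mul_left)
    (fun x _ => hf.differentiable (by simp) x) (fun x _ => hψ1.differentiable (by simp) x)
  have e1 : ∫ x, fderiv ℝ (fun x : Rn n => inner ℝ e x * ψ x) x e * ψ x =
      (∫ x, ψ x * ψ x) + ∫ x, inner ℝ e x * fderiv ℝ ψ x e * ψ x := by
    rw [← integral_add hi1 hi2]
    refine integral_congr_ae (ae_of_all _ fun x => ?_)
    simp only [hfd]
    ring
  have e2 : ∫ x, inner ℝ e x * ψ x * fderiv ℝ ψ x e =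
      ∫ x, inner ℝ e x * fderiv ℝ ψ x e * ψ x :=
    integral_congr_ae (ae_of_all _ fun x => by ring)
  rw [e1, e2] at key
  -- Young's inequality weighted so that half of `∫ ψ²` is absorbed on the left, leaving `∫ ψ² ≤
  -- (2R)² ∫ |∇ψ|²`. The slab bound is needed only in `Ω`, as `ψ` vanishes elsewhere.
  have hpt : ∀ x, -(2 * (inner ℝ e x * fderiv ℝ ψ x e * ψ x)) ≤
      1 / 2 * (ψ x * ψ x) + 2 * R ^ 2 * ‖(∇ ψ : Rn n → Rn n) x‖ ^ 2 := by
    intro x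
    by_cases hx : x ∈ Ω
    · have h1 : |fderiv ℝ ψ x e| ≤ ‖(∇ ψ : Rn n → Rn n) x‖ := by
        rw [← inner_gradient]
        simpa [he] using abs_real_inner_le_norm ((∇ ψ : Rn n → Rn n) x) e
      have h2 : (inner ℝ e x * fderiv ℝ ψ x e) ^ 2 ≤ R ^ 2 * ‖(∇ ψ : Rn n → Rn n) x‖ ^ 2 := by
        rw [← mul_pow, ← sq_abs, abs_mul]
        have := hΩ x hx
        gcongr
      nlinarith [sq_nonneg (ψ x + 2 * (inner ℝ e x * fderiv ℝ ψ x e))]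
    · have : ψ x = 0 := image_eq_zero_of_notMem_tsupport fun h => hx (ψ.tsupport_subset h)
      rw [this]
      simp only [mul_zero, neg_zero, zero_add]
      positivity
  have hint := integral_mono ((hi2.const_mul 2).neg)
    ((hi1.const_mul (1 / 2)).add (hi3.const_mul (2 * R ^ 2))) hpt
  have hs : ∫ x, -(2 * (inner ℝ e x * fderiv ℝ ψ x e * ψ x)) =
      -(2 * ∫ x, inner ℝ e x * fderiv ℝ ψ x e * ψ x) := by
    rw [integral_neg, integral_const_mul]
  have hs' : ∫ x, (1 / 2 * (ψ x * ψ x) + 2 * R ^ 2 * ‖(∇ ψ : Rn n → Rn n) x‖ ^ 2) =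
      1 / 2 * (∫ x, ψ x * ψ x) + 2 * R ^ 2 * ∫ x, ‖(∇ ψ : Rn n → Rn n) x‖ ^ 2 := by
    rw [integral_add (hi1.const_mul _) (hi3.const_mul _), integral_const_mul, integral_const_mul]
  have hint' : -(2 * ∫ x, inner ℝ e x * fderiv ℝ ψ x e * ψ x) ≤
      1 / 2 * (∫ x, ψ x * ψ x) + 2 * R ^ 2 * ∫ x, ‖(∇ ψ : Rn n → Rn n) x‖ ^ 2 := by
    rw [← hs, ← hs']
    exact hint
  have n1 : ‖(testScalar ψ).fst‖ ^ 2 = ∫ x, ψ x * ψ x := by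
    refine (norm_sq_toLp (memLp_testFunction ψ)).trans ?_
    rw [setIntegral_eq_integral_of_forall_compl_eq_zero]
    · exact integral_congr_ae (ae_of_all _ fun x => by simp [pow_two])
    · intro x hx
      rw [image_eq_zero_of_notMem_tsupport fun h => hx (ψ.tsupport_subset h)]
      simp
  have n2 : ‖(testScalar ψ).snd‖ ^ 2 = ∫ x, ‖(∇ ψ : Rn n → Rn n) x‖ ^ 2 := by
    refine (norm_sq_toLp (memLp_gradient ψ)).trans ?_
    rw [setIntegral_eq_integral_of_forall_compl_eq_zero]
    intro x hx
    have : fderiv ℝ ψ x = 0 := image_eq_zero_of_notMem_tsupport fun h =>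
      hx (ψ.tsupport_subset (tsupport_fderiv_subset ℝ h))
    simp [gradient, this]
  refine abs_le_of_sq_le_sq' ?_ (by positivity) |>.2
  rw [mul_pow, n1, n2]
  nlinarith

theorem norm_fst_le_of_mem_H10 {e : Rn n} (he : ‖e‖ = 1) {R : ℝ} (hR : 0 ≤ R)
    (hΩ : ∀ x ∈ Ω, |inner ℝ e x| ≤ R) {φ : ScalarPair Ω} (hφ : φ ∈ H10 Ω) :
    ‖φ.fst‖ ≤ 2 * R * ‖φ.snd‖ := by
  have hc : IsClosed {φ : ScalarPair Ω | ‖φ.fst‖ ≤ 2 * R * ‖φ.snd‖} :=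
    isClosed_le (by fun_prop) (by fun_prop)
  refine closure_minimal (fun φ hφ => ?_) hc hφ
  obtain ⟨ψ, rfl⟩ := mem_span_range_testScalar hφ
  exact norm_testScalar_fst_le he hR hΩ ψ

theorem exists_norm_fst_le_of_mem_H10 (hn : 1 ≤ n)
    (hΩ : Bornology.IsBounded (Ω : Set (Rn n))) :
    ∃ C : ℝ, ∀ φ ∈ H10 Ω, ‖φ.fst‖ ≤ C * ‖φ.snd‖ := by
  obtain ⟨R, hR, hΩR⟩ := hΩ.exists_pos_norm_le
  have he : ‖(EuclideanSpace.single ⟨0, hn⟩ 1 : Rn n)‖ = 1 := by simp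
  refine ⟨2 * R, fun φ hφ => norm_fst_le_of_mem_H10 he hR.le (fun x hx => ?_) hφ⟩
  refine (abs_real_inner_le_norm _ _).trans ?_
  rw [he, one_mul]
  exact hΩR x hx

end Formal

/-! ### Translation estimates for `H¹` functions. -/

section Translation

variable {n : ℕ} {Ω E : Opens (Rn n)}

/-- Test functions are dense in `L²(E)`, their orthogonal complement being trivial by the
fundamental lemma of the calculus of variations. The bound then extends to all `u`, and `u = g`
gives the claim. -/
theorem norm_le_of_inner_testScalar_le (g : L2 E) {C : ℝ} (hC0 : 0 ≤ C)
    (hC : ∀ φ : 𝓓(E, ℝ), inner ℝ g (testScalar φ).fst ≤ C * ‖(testScalar φ).fst‖) :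
    ‖g‖ ≤ C := by
  let S : Submodule ℝ (L2 E) := (Submodule.span ℝ (Set.range (testScalar (Ω := E)))).map
    (WithLp.fstₗ 2 ℝ (L2 E) (L2Vec E))
  have hS : Sᗮ = ⊥ := by
    rw [Submodule.eq_bot_iff]
    intro u hu
    rw [Submodule.mem_orthogonal'] at hu
    have hu0 : ∀ᵐ x, x ∈ (E : Set (Rn n)) → u x = 0 := by
      refine E.isOpen.ae_eq_zero_of_integral_contDiff_smul_eq_zero ?_ fun φ h1 h2 h3 => ?_
      · have : LocallyIntegrable u ((volume : Measure (Rn n)).restrict (E : Set (Rn n))) :=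
          (Lp.memLp u).locallyIntegrable (by norm_num)
        exact locallyIntegrableOn_of_locallyIntegrable_restrict this
      · let ψ : 𝓓(E, ℝ) := ⟨φ, h1, h2, h3⟩
        have h := hu _ ⟨_, Submodule.subset_span ⟨ψ, rfl⟩, rfl⟩
        have h' : inner ℝ u (testScalar ψ).fst = 0 := h
        rw [inner_testScalar_fst, setIntegral_eq_integral_of_forall_compl_eq_zero] at h'
        · rw [← h']
          exact integral_congr_ae (ae_of_all _ fun x => rfl)
        · intro x hx
          rw [image_eq_zero_of_notMem_tsupport fun h => hx (ψ.tsupport_subset h),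
            inner_zero_right]
    rw [Lp.eq_zero_iff_ae_eq_zero]
    exact (ae_restrict_iff' E.isOpen.measurableSet).2 hu0
  have hd : g ∈ closure (S : Set (L2 E)) := by
    rw [← Submodule.topologicalClosure_coe, (Submodule.topologicalClosure_eq_top_iff).2 hS]
    trivial
  have hc : IsClosed {u : L2 E | inner ℝ g u ≤ C * ‖u‖} :=
    isClosed_le (by fun_prop) (by fun_prop)
  have hg : inner ℝ g g ≤ C * ‖g‖ := by
    refine closure_minimal (fun u hu => ?_) hc hd
    obtain ⟨φ, hφ, rfl⟩ := hu
    obtain ⟨ψ, rfl⟩ := mem_span_range_testScalar hφ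
    exact hC ψ
  rw [real_inner_self_eq_norm_sq, pow_two] at hg
  rcases (norm_nonneg g).eq_or_lt with h | h
  · exact h ▸ hC0
  · exact le_of_mul_le_mul_right hg h

/-- The test field `x ↦ φ(x - s h) h`. -/
noncomputable def translateField (φ : 𝓓(E, ℝ)) (h : Rn n) (s : ℝ)
    (hs : ∀ x ∈ E, x + s • h ∈ Ω) : 𝓓(Ω, Rn n) where
  toFun x := φ (x - s • h) • h
  contDiff' := by
    have := φ.contDiff
    fun_prop
  hasCompactSupport' :=
    (φ.hasCompactSupport.comp_homeomorph (Homeomorph.subRight (s • h))).smul_right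
  tsupport_subset' := by
    refine (tsupport_smul_subset_left (fun x => φ (x - s • h)) fun _ => h).trans fun x hx => ?_
    have h1 : x - s • h ∈ tsupport φ := by
      have := tsupport_comp_eq_preimage φ (Homeomorph.subRight (s • h))
      exact (this ▸ hx : x ∈ (Homeomorph.subRight (s • h)) ⁻¹' tsupport φ)
    simpa using hs _ (φ.tsupport_subset h1)

theorem divergence_translateField (φ : 𝓓(E, ℝ)) (h : Rn n) (s : ℝ)
    (hs : ∀ x ∈ E, x + s • h ∈ Ω) (x : Rn n) :
    divergence (translateField φ h s hs) x = fderiv ℝ φ (x - s • h) h := by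
  have h1 : HasFDerivAt (fun x => φ (x - s • h)) (fderiv ℝ φ (x - s • h)) x := by
    have h2 := (φ.contDiff.differentiable (by simp) (x - s • h)).hasFDerivAt
    exact h2.comp x ((hasFDerivAt_id x).sub_const (s • h))
  have h2 : fderiv ℝ (translateField φ h s hs) x = (fderiv ℝ φ (x - s • h)).smulRight h :=
    (h1.smul_const h).fderiv
  rw [divergence, h2]
  conv_rhs => enter [2]; rw [← (EuclideanSpace.basisFun (Fin n) ℝ).sum_repr h]
  simp [mul_comm]

theorem norm_testVector_translateField_le (φ : 𝓓(E, ℝ)) (h : Rn n) (s : ℝ)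
    (hs : ∀ x ∈ E, x + s • h ∈ Ω) :
    ‖(testVector (translateField φ h s hs)).fst‖ ≤ ‖h‖ * ‖(testScalar φ).fst‖ := by
  refine abs_le_of_sq_le_sq' ?_ (by positivity) |>.2
  have n1 : ‖(testScalar φ).fst‖ ^ 2 = ∫ x, ‖φ x‖ ^ 2 := by
    refine (norm_sq_toLp (memLp_testFunction φ)).trans ?_
    rw [setIntegral_eq_integral_of_forall_compl_eq_zero]
    intro x hx
    rw [image_eq_zero_of_notMem_tsupport fun h => hx (φ.tsupport_subset h)]
    simp
  have n2 : ‖(testVector (translateField φ h s hs)).fst‖ ^ 2 =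
      ∫ x, ‖translateField φ h s hs x‖ ^ 2 := by
    refine (norm_sq_toLp (memLp_testFunction (translateField φ h s hs))).trans ?_
    rw [setIntegral_eq_integral_of_forall_compl_eq_zero]
    intro x hx
    rw [image_eq_zero_of_notMem_tsupport
      fun h' => hx ((translateField φ h s hs).tsupport_subset h')]
    simp
  rw [mul_pow, n1, n2, ← integral_const_mul]
  refine le_of_eq ?_
  rw [← integral_sub_right_eq_self (fun x => ‖h‖ ^ 2 * ‖φ x‖ ^ 2) (s • h)]
  refine integral_congr_ae (ae_of_all _ fun x => ?_)
  change ‖φ (x - s • h) • h‖ ^ 2 = _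
  rw [norm_smul, mul_pow, mul_comm]

/-- Along `s ↦ ∫ f φ(x - s h)` the derivative is the pairing of `∇f` with the field `φ(x - s h) h`,
a test field in `Ω` because the shifted support stays inside. Cauchy–Schwarz and the mean value
inequality on `[0, 1]` conclude, without approximating `f` by smooth functions. -/
theorem abs_integral_translate_sub_le (hΩ : Bornology.IsBounded (Ω : Set (Rn n)))
    {p : ScalarPair Ω} (hp : p ∈ H1 Ω) {h : Rn n}
    (hE : ∀ x ∈ E, ∀ s ∈ Set.Icc (0 : ℝ) 1, x + s • h ∈ Ω) (φ : 𝓓(E, ℝ)) :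
    |(∫ x in (Ω : Set (Rn n)), p.fst x * φ (x - h)) -
      ∫ x in (Ω : Set (Rn n)), p.fst x * φ x| ≤
      ‖h‖ * ‖p.snd‖ * ‖(testScalar φ).fst‖ := by
  have : IsFiniteMeasure ((volume : Measure (Rn n)).restrict (Ω : Set (Rn n))) :=
    ⟨by rw [Measure.restrict_apply_univ]; exact hΩ.measure_lt_top⟩
  have hint : Integrable p.fst ((volume : Measure (Rn n)).restrict (Ω : Set (Rn n))) :=
    (Lp.memLp p.fst).integrable (by norm_num)
  have hdφ : Continuous (fderiv ℝ φ) := φ.contDiff.continuous_fderiv (by simp)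
  obtain ⟨M, hM⟩ := hdφ.bounded_above_of_compact_support (φ.hasCompactSupport.fderiv (𝕜 := ℝ))
  obtain ⟨M', hM'⟩ := φ.continuous.bounded_above_of_compact_support φ.hasCompactSupport
  let G : ℝ → ℝ := fun s => ∫ x in (Ω : Set (Rn n)), p.fst x * φ (x - s • h)
  let G' : ℝ → ℝ := fun s => ∫ x in (Ω : Set (Rn n)), p.fst x * -(fderiv ℝ φ (x - s • h) h)
  have hG : ∀ s, HasDerivAt G (G' s) s := by
    intro s
    refine (hasDerivAt_integral_of_dominated_loc_of_deriv_le (s := Set.univ) Filter.univ_mem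
      (F := fun s x => p.fst x * φ (x - s • h))
      (F' := fun s x => p.fst x * -(fderiv ℝ φ (x - s • h) h))
      (bound := fun x => ‖p.fst x‖ * (M * ‖h‖)) ?_ ?_ ?_ ?_ ?_ ?_).2
    · refine Filter.Eventually.of_forall fun t => hint.aestronglyMeasurable.mul ?_
      have := φ.continuous
      exact (by fun_prop : Continuous fun x => φ (x - t • h)).aestronglyMeasurable
    · refine hint.mul_bdd (c := M') ?_ (ae_of_all _ fun x => hM' _)
      have := φ.continuous
      exact (by fun_prop : Continuous fun x => φ (x - s • h)).aestronglyMeasurable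
    · refine hint.aestronglyMeasurable.mul ?_
      exact (by fun_prop : Continuous fun x => -(fderiv ℝ φ (x - s • h) h)).aestronglyMeasurable
    · refine ae_of_all _ fun x t _ => ?_
      rw [norm_mul, norm_neg]
      gcongr
      exact ((fderiv ℝ φ (x - t • h)).le_opNorm h).trans (by gcongr; exact hM _)
    · exact hint.norm.mul_const _
    · refine ae_of_all _ fun x t _ => HasDerivAt.const_mul _ ?_
      have h1 := (φ.contDiff.differentiable (by simp) (x - t • h)).hasFDerivAt
      have h2 : HasDerivAt (fun t : ℝ => x - t • h) (-h) t := by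
        simpa using ((hasDerivAt_id t).smul_const h).const_sub x
      have h3 := h1.comp_hasDerivAt t h2
      rwa [map_neg] at h3
  have hbound : ∀ s ∈ Set.Ico (0 : ℝ) 1, ‖G' s‖ ≤ ‖h‖ * ‖p.snd‖ * ‖(testScalar φ).fst‖ := by
    intro s hs
    have hs' : ∀ x ∈ E, x + s • h ∈ Ω := fun x hx => hE x hx s ⟨hs.1, hs.2.le⟩
    have e1 : G' s = inner ℝ p.snd (testVector (translateField φ h s hs')).fst := by
      have h1 : ∫ x in (Ω : Set (Rn n)), inner ℝ (p.snd x) (translateField φ h s hs' x) =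
        -∫ x in (Ω : Set (Rn n)), p.fst x * divergence (translateField φ h s hs') x :=
        hp (translateField φ h s hs')
      rw [inner_testVector_fst, h1, ← integral_neg]
      refine integral_congr_ae (ae_of_all _ fun x => ?_)
      simp only [divergence_translateField, mul_neg]
    rw [e1, mul_comm ‖h‖, mul_assoc]
    refine (norm_inner_le_norm _ _).trans ?_
    gcongr
    exact norm_testVector_translateField_le φ h s hs'
  have := norm_image_sub_le_of_norm_deriv_le_segment_01' (f := G) (f' := G')
    (fun s _ => (hG s).hasDerivWithinAt) hbound
  simpa [G] using this

/-- The points `x` for which the segment from `x` to `x + h` lies in `Ω`. -/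
def segmentDomain (Ω : Opens (Rn n)) (h : Rn n) : Opens (Rn n) where
  carrier := {x | ∀ s ∈ Set.Icc (0 : ℝ) 1, x + s • h ∈ Ω}
  is_open' := by
    rw [isOpen_iff_mem_nhds]
    intro x hx
    -- Tube lemma: compactness of `[0, 1]` makes the neighbourhood of `x` uniform in `s`.
    refine isCompact_Icc.eventually_forall_of_forall_eventually fun s hs => ?_
    have hc : Continuous fun q : Rn n × ℝ => q.1 + q.2 • h := by fun_prop
    exact hc.continuousAt.preimage_mem_nhds (Ω.isOpen.mem_nhds (hx s hs))

theorem memLp_indicator (f : L2 Ω) : MemLp ((Ω : Set (Rn n)).indicator f) 2 volume :=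
  (memLp_indicator_iff_restrict Ω.isOpen.measurableSet).2 (Lp.memLp f)

/-- Dual form of `abs_integral_translate_sub_le`: a change of variables moves the shift from `φ` to
`f`. Extension by zero is harmless, since `x` and `x + h` both lie in `Ω` on `segmentDomain Ω h`. -/
theorem lintegral_translate_sub_le (hΩ : Bornology.IsBounded (Ω : Set (Rn n)))
    {p : ScalarPair Ω} (hp : p ∈ H1 Ω) (h : Rn n) :
    ∫⁻ x in (segmentDomain Ω h : Set (Rn n)),
      ‖(Ω : Set (Rn n)).indicator p.fst (x + h) - (Ω : Set (Rn n)).indicator p.fst x‖ₑ ^ 2 ≤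
      ENNReal.ofReal ((‖h‖ * ‖p.snd‖) ^ 2) := by
  set f : Rn n → ℝ := (Ω : Set (Rn n)).indicator p.fst with hf
  have hfL : MemLp f 2 volume := memLp_indicator p.fst
  have hfh : MemLp (fun x => f (x + h)) 2 volume :=
    hfL.comp_measurePreserving (measurePreserving_add_right volume h)
  have hg : MemLp (fun x => f (x + h) - f x) 2
      ((volume : Measure (Rn n)).restrict (segmentDomain Ω h : Set (Rn n))) :=
    (hfh.sub hfL).restrict _
  have hnorm : ‖hg.toLp _‖ ≤ ‖h‖ * ‖p.snd‖ := by
    refine norm_le_of_inner_testScalar_le _ (by positivity) fun φ => ?_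
    refine le_trans (le_of_eq ?_) ((le_abs_self _).trans
      (abs_integral_translate_sub_le hΩ hp (E := segmentDomain Ω h) (fun x hx => hx) φ))
    have hφ : MemLp φ 2 (volume : Measure (Rn n)) :=
      φ.continuous.memLp_of_hasCompactSupport φ.hasCompactSupport
    have e0 : ∀ k : Rn n → ℝ, ∫ x in (Ω : Set (Rn n)), p.fst x * k x = ∫ x, f x * k x := by
      intro k
      rw [← integral_indicator Ω.isOpen.measurableSet]
      refine integral_congr_ae (ae_of_all _ fun x => ?_)
      by_cases hx : x ∈ (Ω : Set (Rn n)) <;> simp [hf, hx]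
    rw [inner_testScalar_fst, e0, e0, ← integral_add_right_eq_self (fun x => f x * φ (x - h)) h,
      ← integral_sub]
    · rw [← setIntegral_eq_integral_of_forall_compl_eq_zero
        (s := (segmentDomain Ω h : Set (Rn n)))
        (f := fun x => f (x + h) * φ (x + h - h) - f x * φ x)]
      · refine integral_congr_ae ?_
        filter_upwards [MemLp.coeFn_toLp hg] with x hx
        rw [hx]
        simp
        ring
      · intro x hx
        rw [add_sub_cancel_right,
          image_eq_zero_of_notMem_tsupport fun h => hx (φ.tsupport_subset h)]
        simp
    · simp only [add_sub_cancel_right]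
      exact hfh.integrable_mul hφ
    · exact hfL.integrable_mul hφ
  have e : ∫⁻ x in (segmentDomain Ω h : Set (Rn n)), ‖f (x + h) - f x‖ₑ ^ 2 =
      ENNReal.ofReal (‖hg.toLp _‖ ^ 2) := by
    rw [norm_sq_toLp, ofReal_integral_eq_lintegral_ofReal hg.norm.integrable_sq
      (ae_of_all _ fun x => by positivity)]
    refine lintegral_congr fun x => ?_
    rw [ENNReal.ofReal_pow (norm_nonneg _), ofReal_norm]
  rw [e]
  gcongr

end Translation

/-! ### Poincaré inequality through visible balls, and closedness of `∇H¹`. -/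

section Poincare

variable {n : ℕ} {Ω : Opens (Rn n)}

theorem measurable_indicator_coeFn (f : L2 Ω) : Measurable ((Ω : Set (Rn n)).indicator f) :=
  (Lp.stronglyMeasurable f).measurable.indicator Ω.isOpen.measurableSet

/-- Two-point estimate: if all segments joining `A` to `B` lie in `Ω`, the mean square oscillation
of `f` between `A` and `B` is controlled by the gradient of `f`. -/
theorem lintegral_lintegral_sub_le (hΩ : Bornology.IsBounded (Ω : Set (Rn n)))
    {A B : Set (Rn n)} (hA : MeasurableSet A) (hB : MeasurableSet B)
    (hAB : ∀ x ∈ A, ∀ y ∈ B, x ∈ segmentDomain Ω (y - x))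
    {D : ℝ} (hD : ∀ x ∈ Ω, ∀ y ∈ Ω, ‖y - x‖ ≤ D) {p : ScalarPair Ω} (hp : p ∈ H1 Ω) :
    ∫⁻ x in A, ∫⁻ y in B,
      ‖(Ω : Set (Rn n)).indicator p.fst y - (Ω : Set (Rn n)).indicator p.fst x‖ₑ ^ 2 ≤
      ENNReal.ofReal ((D * ‖p.snd‖) ^ 2) * volume (Metric.closedBall (0 : Rn n) D) := by
  have hm := measurable_indicator_coeFn p.fst
  have htr := fun h => lintegral_translate_sub_le hΩ hp h
  set f : Rn n → ℝ := (Ω : Set (Rn n)).indicator p.fst with hf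
  let k : Rn n × Rn n → ENNReal := (A ×ˢ B).indicator fun q => ‖f q.2 - f q.1‖ₑ ^ 2
  have hk : Measurable k :=
    (((hm.comp measurable_snd).sub (hm.comp measurable_fst)).enorm.pow_const 2).indicator
      (hA.prod hB)
  -- Substituting `y = x + h` and exchanging the integrals leaves, for each fixed `h`, a translation
  -- difference on part of `segmentDomain Ω h`. Only `‖h‖ ≤ D` contributes.
  have e1 : ∫⁻ x in A, ∫⁻ y in B, ‖f y - f x‖ₑ ^ 2 = ∫⁻ x, ∫⁻ h, k (x, x + h) := by
    rw [← lintegral_indicator hA]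
    refine lintegral_congr fun x => ?_
    rw [lintegral_add_left_eq_self (fun y => k (x, y)) x]
    by_cases hx : x ∈ A
    · rw [Set.indicator_of_mem hx, ← lintegral_indicator hB]
      refine lintegral_congr fun y => ?_
      by_cases hy : y ∈ B <;> simp [k, hx, hy]
    · rw [Set.indicator_of_notMem hx]
      simp [k, hx]
  have hk' : Measurable fun q : Rn n × Rn n => k (q.1, q.1 + q.2) :=
    hk.comp (measurable_fst.prodMk (measurable_fst.add measurable_snd))
  rw [e1, lintegral_lintegral_swap hk'.aemeasurable]
  calc ∫⁻ h, ∫⁻ x, k (x, x + h)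
      ≤ ∫⁻ h, (Metric.closedBall (0 : Rn n) D).indicator
          (fun _ => ENNReal.ofReal ((D * ‖p.snd‖) ^ 2)) h := by
        refine lintegral_mono fun h => ?_
        by_cases hh : h ∈ Metric.closedBall (0 : Rn n) D
        · rw [Set.indicator_of_mem hh]
          rw [mem_closedBall_zero_iff] at hh
          refine (le_trans ?_ (htr h)).trans ?_
          · rw [← lintegral_indicator (segmentDomain Ω h).isOpen.measurableSet]
            refine lintegral_mono fun x => ?_
            by_cases hx : (x, x + h) ∈ A ×ˢ B
            · have hx' : x ∈ (segmentDomain Ω h : Set (Rn n)) := by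
                simpa using hAB x hx.1 (x + h) hx.2
              simp only [k, Set.indicator_of_mem hx, Set.indicator_of_mem hx', le_refl]
            · simp only [k, Set.indicator_of_notMem hx, zero_le]
          · gcongr
        · rw [Set.indicator_of_notMem hh]
          refine le_of_eq (lintegral_eq_zero_of_ae_eq_zero (ae_of_all _ fun x => ?_))
          refine Set.indicator_of_notMem (fun hx => hh ?_) _
          have hx' := hAB x hx.1 (x + h) hx.2
          rw [mem_closedBall_zero_iff]
          simpa using hD x (by simpa using hx' 0 (by simp)) (x + h) (by simpa using hx' 1 (by simp))
    _ = _ := by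
        rw [lintegral_indicator_const Metric.isClosed_closedBall.measurableSet]

/-- With zero mean the cross term disappears: `∫_B (f - a)² = ∫_B f² + |B| a²`. Taking `a = f x`
turns the two-point estimate into a bound on `f` itself. -/
theorem volume_mul_enorm_sq_le {B : Set (Rn n)} (hBfin : volume B ≠ ⊤)
    {f : Rn n → ℝ} (hf : MemLp f 2 volume) (hB0 : ∫ y in B, f y = 0) (a : ℝ) :
    volume B * ‖a‖ₑ ^ 2 ≤ ∫⁻ y in B, ‖f y - a‖ₑ ^ 2 := by
  have hfin : IsFiniteMeasure ((volume : Measure (Rn n)).restrict B) :=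
    ⟨by rw [Measure.restrict_apply_univ]; exact hBfin.lt_top⟩
  have hf' := hf.restrict B
  have hi := hf'.integrable (by norm_num)
  have hsub : MemLp (fun y => f y - a) 2 ((volume : Measure (Rn n)).restrict B) :=
    hf'.sub (memLp_const a)
  have hle : (volume B).toReal * a ^ 2 ≤ ∫ y in B, (f y - a) ^ 2 := by
    have h1 : ∫ y in B, (a ^ 2 - 2 * a * f y) = (volume B).toReal * a ^ 2 := by
      rw [integral_sub (integrable_const _) (hi.const_mul _), integral_const_mul, hB0]
      simp [Measure.real]
    rw [← h1]
    refine integral_mono ((integrable_const _).sub (hi.const_mul _)) hsub.integrable_sq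
      fun y => ?_
    change a ^ 2 - 2 * a * f y ≤ (f y - a) ^ 2
    nlinarith [sq_nonneg (f y)]
  have e1 : ∫⁻ y in B, ‖f y - a‖ₑ ^ 2 = ENNReal.ofReal (∫ y in B, (f y - a) ^ 2) := by
    rw [ofReal_integral_eq_lintegral_ofReal hsub.integrable_sq
      (ae_of_all _ fun x => by positivity)]
    refine lintegral_congr fun x => ?_
    rw [← sq_abs, ENNReal.ofReal_pow (abs_nonneg _), ← Real.norm_eq_abs, ofReal_norm]
  have e2 : volume B * ‖a‖ₑ ^ 2 = ENNReal.ofReal ((volume B).toReal * a ^ 2) := by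
    rw [ENNReal.ofReal_mul ENNReal.toReal_nonneg, ENNReal.ofReal_toReal hBfin, ← sq_abs,
      ENNReal.ofReal_pow (abs_nonneg _), ← Real.norm_eq_abs, ofReal_norm]
  rw [e1, e2]
  exact ENNReal.ofReal_le_ofReal hle

theorem exists_lintegral_enorm_sq_le (hΩ : Bornology.IsBounded (Ω : Set (Rn n)))
    {A B : Set (Rn n)} (hA : MeasurableSet A) (hB : MeasurableSet B) (hAΩ : A ⊆ Ω) (hBΩ : B ⊆ Ω)
    (hB0 : volume B ≠ 0) (hAB : ∀ x ∈ A, ∀ y ∈ B, x ∈ segmentDomain Ω (y - x)) :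
    ∃ c : ENNReal, c ≠ ⊤ ∧ ∀ p ∈ H1 Ω, ∫ y in B, p.fst y = 0 →
      ∫⁻ x in A, ‖p.fst x‖ₑ ^ 2 ≤ c * ENNReal.ofReal (‖p.snd‖ ^ 2) := by
  obtain ⟨R, hR0, hR⟩ := hΩ.exists_pos_norm_le
  have hD : ∀ x ∈ Ω, ∀ y ∈ Ω, ‖y - x‖ ≤ R + R := fun x hx y hy =>
    (norm_sub_le y x).trans (add_le_add (hR y hy) (hR x hx))
  have hBfin : volume B ≠ ⊤ := ((measure_mono hBΩ).trans_lt hΩ.measure_lt_top).ne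
  refine ⟨(volume B)⁻¹ * (ENNReal.ofReal ((R + R) ^ 2) *
    volume (Metric.closedBall (0 : Rn n) (R + R))), ?_, fun p hp hp0 => ?_⟩
  · exact ENNReal.mul_ne_top (ENNReal.inv_ne_top.2 hB0)
      (ENNReal.mul_ne_top ENNReal.ofReal_ne_top measure_closedBall_lt_top.ne)
  · have h1 := lintegral_lintegral_sub_le hΩ hA hB hAB hD hp
    have hfB : ∫ y in B, (Ω : Set (Rn n)).indicator p.fst y = 0 := by
      rw [← hp0]
      exact setIntegral_congr_fun hB fun y hy => Set.indicator_of_mem (hBΩ hy) _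
    have h2 : volume B * ∫⁻ x in A, ‖p.fst x‖ₑ ^ 2 ≤
        ENNReal.ofReal (((R + R) * ‖p.snd‖) ^ 2) *
          volume (Metric.closedBall (0 : Rn n) (R + R)) := by
      refine le_trans ?_ h1
      rw [← lintegral_const_mul' _ _ hBfin]
      refine setLIntegral_mono' hA fun x hx => ?_
      have := volume_mul_enorm_sq_le hBfin (memLp_indicator p.fst) hfB
        ((Ω : Set (Rn n)).indicator p.fst x)
      rwa [Set.indicator_of_mem (hAΩ hx)] at this ⊢
    rw [mul_pow, ENNReal.ofReal_mul (by positivity)] at h2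
    calc ∫⁻ x in A, ‖p.fst x‖ₑ ^ 2
        = (volume B)⁻¹ * (volume B * ∫⁻ x in A, ‖p.fst x‖ₑ ^ 2) := by
          rw [← mul_assoc, ENNReal.inv_mul_cancel hB0 hBfin, one_mul]
      _ ≤ (volume B)⁻¹ * (ENNReal.ofReal ((R + R) ^ 2) * ENNReal.ofReal (‖p.snd‖ ^ 2) *
          volume (Metric.closedBall (0 : Rn n) (R + R))) := by gcongr
      _ = _ := by ring

/-- Near a point of the closure of a Lipschitz domain, all points of the domain see a common
ball inside the domain. -/
theorem HasLipschitzBoundary.exists_visible_ball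
    (hL : HasLipschitzBoundary (Ω : Set (Rn n))) {x₀ : Rn n}
    (hx₀ : x₀ ∈ closure (Ω : Set (Rn n))) :
    ∃ ρ : ℝ, 0 < ρ ∧ ∃ c : Rn n, Metric.ball c ρ ⊆ Ω ∧
      ∀ x ∈ (Ω : Set (Rn n)) ∩ Metric.ball x₀ ρ, ∀ y ∈ Metric.ball c ρ,
        x ∈ segmentDomain Ω (y - x) := by
  by_cases hx : x₀ ∈ Ω
  · obtain ⟨ρ, hρ, hball⟩ := Metric.isOpen_iff.1 Ω.isOpen x₀ hx
    exact ⟨ρ, hρ, x₀, hball, fun x hx y hy s hs => hball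
      ((convex_ball x₀ ρ).add_smul_sub_mem hx.2 hy hs)⟩
  have hfr : x₀ ∈ frontier (Ω : Set (Rn n)) := by
    rw [Ω.isOpen.frontier_eq]
    exact ⟨hx₀, hx⟩
  obtain ⟨e, r, K, γ, he, hr, hγ, hU⟩ := hL x₀ hfr
  let P := (Submodule.span ℝ {e})ᗮ.orthogonalProjectionOnto
  have hU : ∀ x ∈ Metric.ball x₀ r, (x ∈ Ω ↔ γ (P x) < inner ℝ e x) := hU
  have hPe : P e = 0 := Submodule.orthogonalProjectionOnto_orthogonal_apply_eq_zero
    (Submodule.mem_span_singleton_self e)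
  have hP : ∀ x, ‖P x‖ ≤ ‖x‖ := fun x =>
    Submodule.norm_orthogonalProjectionOnto_apply_le _ x
  -- Small enough that `2Kρ ≤ r/2 - 2ρ`, so the ascent beats the slope of the graph, and that the
  -- ball about `x₀ + (r/2) e` stays in the chart.
  set ρ : ℝ := r / (8 * (K + 1)) with hρ
  have hK : (0 : ℝ) ≤ K := K.2
  have hρ0 : 0 < ρ := by positivity
  have hρr : 8 * (K + 1) * ρ = r := by rw [hρ]; field_simp
  have hKρ : 0 ≤ K * ρ := by positivity
  have hball : ∀ x ∈ Metric.ball x₀ ρ, x ∈ Metric.ball x₀ r := fun x hx =>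
    Metric.ball_subset_ball (by nlinarith) hx
  have hball' : ∀ y ∈ Metric.ball (x₀ + (r / 2) • e) ρ, y ∈ Metric.ball x₀ r := by
    intro y hy
    rw [mem_ball_iff_norm] at hy ⊢
    calc ‖y - x₀‖ = ‖(y - (x₀ + (r / 2) • e)) + (r / 2) • e‖ := by congr 1; abel
      _ ≤ ‖y - (x₀ + (r / 2) • e)‖ + ‖(r / 2) • e‖ := norm_add_le _ _
      _ < ρ + r / 2 := by
        rw [norm_smul, he, mul_one, Real.norm_of_nonneg (by positivity)]
        gcongr
      _ ≤ r := by nlinarith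
  have hsee : ∀ x ∈ (Ω : Set (Rn n)) ∩ Metric.ball x₀ ρ,
      ∀ y ∈ Metric.ball (x₀ + (r / 2) • e) ρ, x ∈ segmentDomain Ω (y - x) := by
    rintro x ⟨hxΩ, hxb⟩ y hy s hs
    have hz : x + s • (y - x) ∈ Metric.ball x₀ r :=
      (convex_ball x₀ r).add_smul_sub_mem (hball x hxb) (hball' y hy) hs
    have hx1 : γ (P x) < inner ℝ e x := (hU x (hball x hxb)).1 hxΩ
    refine (hU _ hz).2 ?_
    -- The displacement is `(r/2) e` plus an error `w` of size at most `2ρ`. After time `s` the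
    -- height has grown by at least `s (r/2 - 2ρ)` and the graph by at most `2Kρ s`, so the segment
    -- remains above the graph.
    set w : Rn n := (y - (x₀ + (r / 2) • e)) - (x - x₀) with hw
    have hyx : y - x = (r / 2) • e + w := by rw [hw]; abel
    have hwn : ‖w‖ ≤ 2 * ρ := by
      rw [mem_ball_iff_norm] at hy hxb
      exact (norm_sub_le _ _).trans (by linarith)
    have hPz : P (x + s • (y - x)) = P x + s • P w := by
      rw [map_add, map_smul, hyx, map_add, map_smul, hPe, smul_zero, zero_add]
    have hγz : γ (P (x + s • (y - x))) ≤ γ (P x) + K * (s * (2 * ρ)) := by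
      have h1 := hγ.dist_le_mul (P (x + s • (y - x))) (P x)
      rw [hPz, dist_eq_norm, dist_eq_norm, add_sub_cancel_left, norm_smul,
        Real.norm_of_nonneg hs.1, Real.norm_eq_abs] at h1
      have h2 : (K : ℝ) * (s * ‖P w‖) ≤ K * (s * (2 * ρ)) := by
        have := hs.1
        gcongr
        exact (hP w).trans hwn
      rw [hPz]
      linarith [le_abs_self (γ (P x + s • P w) - γ (P x))]
    have hin : inner ℝ e x + s * (r / 2 - 2 * ρ) ≤ inner ℝ e (x + s • (y - x)) := by
      have h1 : -(2 * ρ) ≤ inner ℝ e w := by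
        have := abs_le.1 ((abs_real_inner_le_norm e w))
        rw [he, one_mul] at this
        linarith
      rw [inner_add_right, inner_smul_right, hyx, inner_add_right, inner_smul_right,
        real_inner_self_eq_norm_sq, he]
      have := mul_le_mul_of_nonneg_left h1 hs.1
      linarith
    have h3 : s * (K * (2 * ρ)) ≤ s * (r / 2 - 2 * ρ) :=
      mul_le_mul_of_nonneg_left (by nlinarith) hs.1
    linarith
  refine ⟨ρ, hρ0, x₀ + (r / 2) • e, fun y hy => ?_, hsee⟩
  -- Some point of `Ω` is close to `x₀`; the endpoint `s = 1` of its segment to `y` shows `y ∈ Ω`.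
  obtain ⟨x, hx, hxd⟩ := Metric.mem_closure_iff.1 hx₀ ρ hρ0
  have := hsee x ⟨hx, by rwa [Metric.mem_ball, dist_comm]⟩ y hy 1 (by simp)
  simpa using this

/-- The functional `(f, ∇f) ↦ ∫_B f`. -/
noncomputable def integralOn {B : Set (Rn n)} (hB : MeasurableSet B)
    (hBfin : (volume.restrict (Ω : Set (Rn n))) B ≠ ⊤) : ScalarPair Ω →L[ℝ] ℝ :=
  (innerSL ℝ (indicatorConstLp 2 hB hBfin (1 : ℝ))).comp (WithLp.fstL 2 ℝ (L2 Ω) (L2Vec Ω))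

theorem integralOn_apply {B : Set (Rn n)} (hB : MeasurableSet B) (hBΩ : B ⊆ Ω)
    (hBfin : (volume.restrict (Ω : Set (Rn n))) B ≠ ⊤) (p : ScalarPair Ω) :
    integralOn hB hBfin p = ∫ y in B, p.fst y := by
  refine (L2.inner_indicatorConstLp_one hB hBfin p.fst).trans ?_
  rw [Measure.restrict_restrict_of_subset hBΩ]

/-- The constraints are zero integrals over the visible balls of a finite cover of the closure. They
may well outnumber the components of `Ω`; only their finiteness matters. -/
theorem isClosed_gradImage_H1 (hΩ : Bornology.IsBounded (Ω : Set (Rn n)))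
    (hL : HasLipschitzBoundary (Ω : Set (Rn n))) :
    IsClosed (gradImage (H1 Ω) : Set (L2Vec Ω)) := by
  choose! ρ hρ c hc hsee using fun x₀ : Rn n => hL.exists_visible_ball (x₀ := x₀)
  obtain ⟨t, ht, hcover⟩ := hΩ.isCompact_closure.elim_nhds_subcover
    (fun x => Metric.ball x (ρ x)) fun x hx => Metric.ball_mem_nhds x (hρ x hx)
  have hex : ∀ i : t, ∃ C : ENNReal, C ≠ ⊤ ∧ ∀ p ∈ H1 Ω,
      ∫ y in Metric.ball (c i) (ρ i), p.fst y = 0 →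
        ∫⁻ x in (Ω : Set (Rn n)) ∩ Metric.ball (i : Rn n) (ρ i), ‖p.fst x‖ₑ ^ 2 ≤
          C * ENNReal.ofReal (‖p.snd‖ ^ 2) := by
    intro i
    have hi := ht i i.2
    exact exists_lintegral_enorm_sq_le hΩ (Ω.isOpen.measurableSet.inter measurableSet_ball)
      measurableSet_ball Set.inter_subset_left (hc i hi)
      (Metric.measure_ball_pos volume _ (hρ i hi)).ne' (hsee i hi)
  choose C hCfin hC using hex
  have hfin : ∀ i : t, (volume.restrict (Ω : Set (Rn n))) (Metric.ball (c i) (ρ i)) ≠ ⊤ :=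
    fun i => ((Measure.restrict_apply_le _ _).trans_lt measure_ball_lt_top).ne
  refine isClosed_gradImage_of_bound_of_constraints isClosed_H1
    (fun i : t => integralOn measurableSet_ball (hfin i)) (C := √(∑ i, C i).toReal)
    fun p hp hp0 => ?_
  have hsum : ENNReal.ofReal (‖p.fst‖ ^ 2) ≤ (∑ i, C i) * ENNReal.ofReal (‖p.snd‖ ^ 2) := by
    have e : ENNReal.ofReal (‖p.fst‖ ^ 2) = ∫⁻ x in (Ω : Set (Rn n)), ‖p.fst x‖ₑ ^ 2 := by
      have h1 := norm_sq_toLp (Lp.memLp p.fst)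
      rw [Lp.toLp_coeFn] at h1
      rw [h1, ofReal_integral_eq_lintegral_ofReal (Lp.memLp p.fst).norm.integrable_sq
        (ae_of_all _ fun x => by positivity)]
      refine lintegral_congr fun x => ?_
      rw [ENNReal.ofReal_pow (norm_nonneg _), ofReal_norm]
    rw [e, Finset.sum_mul]
    have hsub : (Ω : Set (Rn n)) ⊆
        ⋃ i : t, (Ω : Set (Rn n)) ∩ Metric.ball (i : Rn n) (ρ i) := by
      intro x hx
      obtain ⟨i, hi, hxi⟩ := Set.mem_iUnion₂.1 (hcover (subset_closure hx))
      exact Set.mem_iUnion.2 ⟨⟨i, hi⟩, hx, hxi⟩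
    refine (lintegral_mono_set hsub).trans ((lintegral_iUnion_le _ _).trans ?_)
    rw [tsum_fintype]
    refine Finset.sum_le_sum fun i _ => hC i p hp ?_
    rw [← integralOn_apply measurableSet_ball (hc i (ht i i.2)) (hfin i)]
    exact hp0 i
  have hCt : ∑ i, C i ≠ ⊤ := ENNReal.sum_ne_top.2 fun i _ => hCfin i
  rw [← ENNReal.ofReal_toReal hCt, ← ENNReal.ofReal_mul ENNReal.toReal_nonneg,
    ENNReal.ofReal_le_ofReal_iff (by positivity)] at hsum
  refine abs_le_of_sq_le_sq' ?_ (by positivity) |>.2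
  rwa [mul_pow, Real.sq_sqrt ENNReal.toReal_nonneg]

end Poincare

end Helmholtz

theorem mainTheorem7 (n : ℕ) (hn : 1 ≤ n) (Ω : Opens (Helmholtz.Rn n))
    (hΩ_bounded : Bornology.IsBounded (Ω : Set (Helmholtz.Rn n)))
    (hΩ_regular : Helmholtz.HasLipschitzBoundary (Ω : Set (Helmholtz.Rn n))) :
    -- the two orthogonal decompositions of `L²(Ω)ⁿ`
    Helmholtz.IsOrthogonalDirectSum
        (Helmholtz.gradImage (Helmholtz.H10 Ω)) (Helmholtz.kerDiv Ω) ∧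
    Helmholtz.IsOrthogonalDirectSum
        (Helmholtz.gradImage (Helmholtz.H1 Ω)) (Helmholtz.kerDivZero Ω) ∧
    -- `Ker(div)₀` consists of the divergence-free fields with zero normal trace
    (∀ v : Helmholtz.L2Vec Ω, v ∈ Helmholtz.kerDivZero Ω ↔
      ∃ p : Helmholtz.HDiv Ω, (p : Helmholtz.VectorPair Ω).fst = v ∧
        (p : Helmholtz.VectorPair Ω).snd = 0 ∧ Helmholtz.normalTrace p = 0) ∧
    -- the components of `f` come from the Dirichlet problem and the Neumann problem
    ∀ f : Helmholtz.L2Vec Ω,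
      (∃! φ : Helmholtz.ScalarPair Ω, Helmholtz.SolvesVariational (Helmholtz.H10 Ω) f φ) ∧
      (∀ φ : Helmholtz.ScalarPair Ω, Helmholtz.SolvesVariational (Helmholtz.H10 Ω) f φ →
        f - φ.snd ∈ Helmholtz.kerDiv Ω) ∧
      (∃ φ : Helmholtz.ScalarPair Ω, Helmholtz.SolvesVariational (Helmholtz.H1 Ω) f φ) ∧
      (∀ φ φ' : Helmholtz.ScalarPair Ω, Helmholtz.SolvesVariational (Helmholtz.H1 Ω) f φ →
        Helmholtz.SolvesVariational (Helmholtz.H1 Ω) f φ' → φ.snd = φ'.snd) ∧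
      (∀ φ : Helmholtz.ScalarPair Ω, Helmholtz.SolvesVariational (Helmholtz.H1 Ω) f φ →
        f - φ.snd ∈ Helmholtz.kerDivZero Ω) := by
  obtain ⟨C, hC⟩ := Helmholtz.exists_norm_fst_le_of_mem_H10 hn hΩ_bounded
  have hc0 := Helmholtz.isClosed_gradImage_of_bound
    (Submodule.isClosed_topologicalClosure
      (Submodule.span ℝ (Set.range (Helmholtz.testScalar (Ω := Ω))))) hC
  have hc1 := Helmholtz.isClosed_gradImage_H1 hΩ_bounded hΩ_regular
  refine ⟨?_, ?_, Helmholtz.mem_kerDivZero_iff_normalTrace, fun f => ⟨?_, fun φ hφ => ?_,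
    Helmholtz.exists_solvesVariational hc1 f, fun φ φ' h h' => h.snd_eq h', fun φ hφ => ?_⟩⟩
  · rw [Helmholtz.kerDiv_eq_orthogonal]
    exact Helmholtz.isOrthogonalDirectSum_orthogonal hc0
  · rw [Helmholtz.kerDivZero_eq_orthogonal]
    exact Helmholtz.isOrthogonalDirectSum_orthogonal hc1
  · obtain ⟨φ, hφ⟩ := Helmholtz.exists_solvesVariational hc0 f
    refine ⟨φ, hφ, fun φ' hφ' => ?_⟩
    -- Equal gradients force equal potentials here, by the Poincaré inequality applied to the
    -- difference in `H10`.
    have hs : (φ' - φ).snd = 0 := sub_eq_zero.2 (hφ'.snd_eq hφ)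
    have hf := hC _ ((Helmholtz.H10 Ω).sub_mem hφ'.1 hφ.1)
    rw [hs, norm_zero, mul_zero, norm_le_zero_iff] at hf
    exact sub_eq_zero.1 (WithLp.ofLp_injective 2 (Prod.ext hf hs))
  · rw [Helmholtz.kerDiv_eq_orthogonal]
    exact (Helmholtz.solvesVariational_iff.1 hφ).2
  · rw [Helmholtz.kerDivZero_eq_orthogonal]
    exact (Helmholtz.solvesVariational_iff.1 hφ).2
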